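/- Let $\mathbb R^+=(0,\infty)$. Let $\mathscr F_{\mathbb R^+}$ be the truncated Fourier operator in $L^2(\mathbb R^+,dt)$, i.e. the bounded operator obtained by continuous extension from $L^1\cap L^2$ of $$(\mathscr F_{\mathbb R^+}x)(t)=\frac1{\sqrt{2\pi}}\int_0^\infty x(\xi)e^{it\xi}\,d\xi ,\quad t\in\mathbb R^+,$$ and let $\mathscr F_{\mathbb R^+}^*$ be its adjoint, which on $L^1\cap L^2$ is given by the same integral with $e^{-it\xi}$. For $t,\mu>0$ put $\psi(t,\mu)=\big[\,t^{-1/2+i\mu}\ \ t^{-1/2-i\mu}\,\big]$, and let $\psi^*(t,\mu)$ be the conjugate transposed column. Let $\mathscr K$ be the Hilbert space of (classes of) measurable functions $y=(y^+,y^-)^T:\mathbb R^+\to\mathbb C^2$ with $\|y\|^2=\int_0^\infty(|y^+(\mu)|^2+|y^-(\mu)|^2)\frac{d\mu}{2\pi}<\infty$. Let $U:L^2(\mathbb R^+)\to\mathscr K$ and $U^{-1}:\mathscr K\to L^2(\mathbb R^+)$ be the continuous operators which on functions with compact support in $(0,\infty)$ are $$(Ux)(\mu)=\hat x(\mu)=\int_0^\infty\psi^*(t,\mu)x(t)\,dt,\qquad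 (U^{-1}y)(t)=\int_0^\infty\psi(t,\mu)y(\mu)\frac{d\mu}{2\pi}$$ (the components of $\hat x(\mu)$ are the values of the Mellin transform of $x$ at $\tfrac12\mp i\mu$); for general $x\in L^2(\mathbb R^+)$, $y\in\mathscr K$ the integrals are understood as these extensions. Put $$F(\mu)=\begin{bmatrix}0&\frac1{\sqrt{2\pi}}e^{i\pi/4+\mu\pi/2}\,\Gamma(\tfrac12-i\mu)\\ \frac1{\sqrt{2\pi}}e^{i\pi/4-\mu\pi/2}\,\Gamma(\tfrac12+i\mu)&0\end{bmatrix},$$ let $F^*(\mu)$ be its Hermitian conjugate, and for a $2\times2$ matrix function $G$ let $\mathcal M_G$ be the operator $(\mathcal M_Gy)(\mu)=G(\mu)y(\mu)$ in $\mathscr K$ with domain $\{y\in\mathscr K: Gy\in\mathscr K\}$. Then these operators are well defined (the extensions exist and are given by the stated integrals on the stated functions). The operators $U$ and $U^{-1}$ are unitary, $U$ maps onto $\mathscr K$, $U^{-1}$ maps onto $L^2(\mathbb R^+)$, and they are inverse to each other. The operators $\mathcal M_F$, $\mathcal M_{F^*}$ are defined on all of $\mathscr K$. For every $x\in L^2(\mathbb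 R^+)$, $$(U\mathscr F_{\mathbb R^+}x)(\mu)=F(\mu)\hat x(\mu),\qquad (U\mathscr F_{\mathbb R^+}^*x)(\mu)=F^*(\mu)\hat x(\mu)\qquad\text{for almost every }\mu>0,$$ and $$(\mathscr F_{\mathbb R^+}x)(t)=\int_0^\infty\psi(t,\mu)F(\mu)\hat x(\mu)\frac{d\mu}{2\pi},\qquad (\mathscr F_{\mathbb R^+}^*x)(t)=\int_0^\infty\psi(t,\mu)F^*(\mu)\hat x(\mu)\frac{d\mu}{2\pi},$$ that is, $\mathscr F_{\mathbb R^+}=U^{-1}\mathcal M_FU$ and $\mathscr F_{\mathbb R^+}^*=U^{-1}\mathcal M_{F^*}U$. -/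

import Mathlib

open MeasureTheory Set Filter

noncomputable section

namespace TruncatedFourier

/-- Lebesgue measure `dt` on the half-axis `(0, ∞)`. -/
abbrev halfMeasure : Measure ℝ := volume.restrict (Ioi 0)

/-- The measure `dμ / 2π` on the half-axis `(0, ∞)`. -/
abbrev modelMeasure : Measure ℝ := ENNReal.ofReal (1 / (2 * Real.pi)) • volume.restrict (Ioi 0)

/-- The space `L²(ℝ⁺)`. -/
abbrev L2Half : Type := Lp ℂ 2 halfMeasure

/-- The model space `𝒦`: classes of functions `y = (y⁺, y⁻) : (0, ∞) → ℂ²` with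
`∫ (|y⁺(μ)|² + |y⁻(μ)|²) dμ / 2π < ∞`. The component `y⁺` has index `0`, `y⁻` has index `1`. -/
abbrev ModelSpace : Type := Lp (EuclideanSpace ℂ (Fin 2)) 2 modelMeasure

section Extension

variable {E F : Type*} [NormedAddCommGroup E] [NormedSpace ℂ E]
  [NormedAddCommGroup F] [NormedSpace ℂ F] {ν : Measure ℝ}

/-- The elements of a domain `D` on which a linear transformation `T`, with values in functions,
takes a square integrable value. -/
def squareDomain (ν' : Measure ℝ) (D : Submodule ℂ (Lp E 2 ν)) (T : D →ₗ[ℂ] (ℝ → F)) :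
    Submodule ℂ D where
  carrier := {x | MemLp (T x) 2 ν'}
  add_mem' {x y} hx hy := by
    simp only [mem_ofPred_eq, map_add] at *
    exact hx.add hy
  zero_mem' := by
    simp only [mem_ofPred_eq, map_zero]
    exact MemLp.zero
  smul_mem' c x hx := by
    simp only [mem_ofPred_eq, map_smul] at *
    exact hx.const_smul c

lemma mem_squareDomain {ν' : Measure ℝ} {D : Submodule ℂ (Lp E 2 ν)} {T : D →ₗ[ℂ] (ℝ → F)}
    {x : D} : x ∈ squareDomain ν' D T ↔ MemLp (T x) 2 ν' := Iff.rfl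

/-- `T` as a linear map into `L²`. -/
def squareMap (ν' : Measure ℝ) (D : Submodule ℂ (Lp E 2 ν)) (T : D →ₗ[ℂ] (ℝ → F)) :
    squareDomain ν' D T →ₗ[ℂ] Lp F 2 ν' where
  toFun x := MemLp.toLp (T x.1) (mem_squareDomain.1 x.2)
  map_add' x y := by
    rw [← MemLp.toLp_add]
    refine MemLp.toLp_congr _ _ ?_
    rw [Submodule.coe_add, map_add]
  map_smul' c x := by
    rw [RingHom.id_apply, ← MemLp.toLp_const_smul]
    refine MemLp.toLp_congr _ _ ?_
    rw [Submodule.coe_smul, map_smul]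

/-- The extension by continuity to all of `L²` of an integral transformation `T` that is given on
a subspace `D` of `L²`. -/
def l2Extension [CompleteSpace F] (ν' : Measure ℝ) (D : Submodule ℂ (Lp E 2 ν))
    (T : D →ₗ[ℂ] (ℝ → F)) : Lp E 2 ν →L[ℂ] Lp F 2 ν' :=
  (squareMap ν' D T).extendOfNorm (D.subtype ∘ₗ (squareDomain ν' D T).subtype)

/-- The functions in `L²(ν)` whose support is a compact subset of `(0, ∞)`. -/
def compactlySupported (E : Type*) [NormedAddCommGroup E] [NormedSpace ℂ E] (ν : Measure ℝ) :
    Submodule ℂ (Lp E 2 ν) where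
  carrier := {x | ∃ a b : ℝ, 0 < a ∧ ∀ᵐ t ∂ν, t ∉ Icc a b → x t = 0}
  add_mem' {x y} := by
    rintro ⟨a, b, ha, hx⟩ ⟨a', b', ha', hy⟩
    refine ⟨min a a', max b b', lt_min ha ha', ?_⟩
    filter_upwards [hx, hy, Lp.coeFn_add x y] with t h1 h2 h3 ht
    rw [h3, Pi.add_apply, h1, h2, add_zero]
    · exact fun h => ht ⟨(min_le_right _ _).trans h.1, h.2.trans (le_max_right _ _)⟩
    · exact fun h => ht ⟨(min_le_left _ _).trans h.1, h.2.trans (le_max_left _ _)⟩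
  zero_mem' := by
    refine ⟨1, 1, one_pos, ?_⟩
    filter_upwards [Lp.coeFn_zero E 2 ν] with t h _
    simpa using h
  smul_mem' c x := by
    rintro ⟨a, b, ha, hx⟩
    refine ⟨a, b, ha, ?_⟩
    filter_upwards [hx, Lp.coeFn_smul c x] with t h1 h2 ht
    rw [h2, Pi.smul_apply, h1 ht, smul_zero]

/-- The functions in `L²(ν) ∩ L¹(ν)`. -/
def integrableFunctions (E : Type*) [NormedAddCommGroup E] [NormedSpace ℂ E] (ν : Measure ℝ) :
    Submodule ℂ (Lp E 2 ν) where
  carrier := {x | Integrable x ν}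
  add_mem' {x y} hx hy := (hx.add hy).congr (Lp.coeFn_add x y).symm
  zero_mem' := (integrable_zero ℝ E ν).congr (Lp.coeFn_zero E 2 ν).symm
  smul_mem' c x hx := (hx.smul c).congr (Lp.coeFn_smul c x).symm

end Extension

/-! ### The truncated Fourier operator -/

/-- `(2π)^{-1/2} ∫₀^∞ x(ξ) e^{itξ} dξ`. -/
def fourierIntegral (x : ℝ → ℂ) (t : ℝ) : ℂ :=
  1 / (Real.sqrt (2 * Real.pi) : ℂ) *
    ∫ ξ, Complex.exp (Complex.I * t * ξ) * x ξ ∂halfMeasure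

lemma integrable_exp_mul {x : ℝ → ℂ} (hx : Integrable x halfMeasure) (t : ℝ) :
    Integrable (fun ξ : ℝ => Complex.exp (Complex.I * t * ξ) * x ξ) halfMeasure := by
  refine hx.bdd_mul (c := 1) (by fun_prop) (ae_of_all _ fun ξ => ?_)
  rw [Complex.norm_exp]
  simp

/-- The integral `fourierIntegral` as a linear map on `L¹(ℝ⁺) ∩ L²(ℝ⁺)`. -/
def fourierLin : integrableFunctions ℂ halfMeasure →ₗ[ℂ] (ℝ → ℂ) where
  toFun x := fourierIntegral (x : L2Half)
  map_add' x y := by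
    funext t
    simp only [fourierIntegral, Pi.add_apply]
    rw [← mul_add, ← integral_add (integrable_exp_mul x.2 t) (integrable_exp_mul y.2 t)]
    congr 1
    refine integral_congr_ae ?_
    filter_upwards [Lp.coeFn_add (x : L2Half) y] with ξ h
    rw [Submodule.coe_add, h, Pi.add_apply, mul_add]
  map_smul' c x := by
    funext t
    simp only [fourierIntegral, Pi.smul_apply, RingHom.id_apply, smul_eq_mul]
    rw [mul_left_comm c, ← integral_const_mul c]
    congr 1
    refine integral_congr_ae ?_
    filter_upwards [Lp.coeFn_smul c (x : L2Half)] with ξ h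
    rw [Submodule.coe_smul, h, Pi.smul_apply, smul_eq_mul, mul_left_comm]

/-- The truncated Fourier operator `(𝓕 x)(t) = (2π)^{-1/2} ∫₀^∞ x(ξ) e^{itξ} dξ` in `L²(ℝ⁺)`,
given by this integral on `L¹(ℝ⁺) ∩ L²(ℝ⁺)` and extended by continuity. -/
def truncatedFourier : L2Half →L[ℂ] L2Half :=
  l2Extension halfMeasure (integrableFunctions ℂ halfMeasure) fourierLin

/-! ### The transformation in the generalized eigenfunctions -/

/-- The row `ψ(t, μ) = [t^{-1/2 + iμ}, t^{-1/2 - iμ}]`. -/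
def psi (t μ : ℝ) : Fin 2 → ℂ :=
  ![(t : ℂ) ^ (-1 / 2 + Complex.I * μ : ℂ), (t : ℂ) ^ (-1 / 2 - Complex.I * μ : ℂ)]

/-- `x̂(μ) = ∫₀^∞ ψ*(t, μ) x(t) dt`. -/
def hat (x : ℝ → ℂ) (μ : ℝ) : EuclideanSpace ℂ (Fin 2) :=
  WithLp.toLp 2 fun i => ∫ t, star (psi t μ i) * x t ∂halfMeasure

/-- `y̌(t) = ∫₀^∞ ψ(t, μ) y(μ) dμ / 2π`. -/
def check (y : ℝ → EuclideanSpace ℂ (Fin 2)) (t : ℝ) : ℂ :=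
  ∫ μ, ∑ i, psi t μ i * y μ i ∂modelMeasure

/-- The components of `x̂` are the values of the Mellin transform of `x` at `1/2 ∓ iμ`. -/
lemma hat_eq_mellin (x : ℝ → ℂ) (μ : ℝ) :
    hat x μ = !₂[mellin x (1 / 2 - Complex.I * μ), mellin x (1 / 2 + Complex.I * μ)] := by
  ext i
  fin_cases i
  all_goals
    simp only [hat, mellin, psi]
    refine setIntegral_congr_fun measurableSet_Ioi fun t ht => ?_
    have ha : (t : ℂ).arg ≠ Real.pi := by
      rw [Complex.arg_ofReal_of_nonneg (le_of_lt ht)]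
      exact Real.pi_ne_zero.symm
    have hc (s : ℂ) : (starRingEnd ℂ) ((t : ℂ) ^ s) = (t : ℂ) ^ (starRingEnd ℂ s) := by
      rw [Complex.cpow_conj _ _ ha, Complex.conj_ofReal]
    simp [hc, map_ofNat]
    left
    congr 1
    ring

lemma continuousOn_psi_left (μ : ℝ) (i : Fin 2) {a b : ℝ} (ha : 0 < a) :
    ContinuousOn (fun t => psi t μ i) (Icc a b) := by
  intro t ht
  have h0 : (t : ℂ) ∈ Complex.slitPlane :=
    Complex.ofReal_mem_slitPlane.2 (ha.trans_le ht.1)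
  refine ContinuousAt.continuousWithinAt ?_
  fin_cases i
  all_goals
    simp only [psi]
    exact ContinuousAt.cpow Complex.continuous_ofReal.continuousAt continuousAt_const h0

lemma continuous_psi_right (t : ℝ) (i : Fin 2) : Continuous (fun μ => psi t μ i) := by
  fin_cases i
  all_goals
    simp only [psi]
    refine Continuous.const_cpow (by fun_prop) (Or.inr fun μ h => ?_)
    have := congrArg Complex.re h
    norm_num at this

lemma integrable_mul_of_compactlySupported {E : Type*} [NormedAddCommGroup E] [NormedSpace ℂ E]
    {ν : Measure ℝ} [IsFiniteMeasureOnCompacts ν] {x : Lp E 2 ν}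
    (hx : x ∈ compactlySupported E ν) {k : ℝ → ℂ}
    (hk : ∀ a b : ℝ, 0 < a → ContinuousOn k (Icc a b)) (L : E →L[ℂ] ℂ) :
    Integrable (fun t => k t * L (x t)) ν := by
  obtain ⟨a, b, ha, h⟩ := hx
  have h1 : IntegrableOn x (Icc a b) ν := by
    have : IsFiniteMeasure (ν.restrict (Icc a b)) :=
      ⟨by rw [Measure.restrict_apply_univ]; exact isCompact_Icc.measure_lt_top⟩
    exact ((Lp.memLp x).restrict (Icc a b)).integrable (by norm_num)
  have h2 : IntegrableOn (fun t => k t * L (x t)) (Icc a b) ν :=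
    IntegrableOn.continuousOn_mul (hk a b ha) (L.integrable_comp h1) isCompact_Icc
  refine h2.integrable_of_ae_notMem_eq_zero ?_
  filter_upwards [h] with t ht hmem
  rw [ht hmem, map_zero, mul_zero]

instance : IsFiniteMeasureOnCompacts modelMeasure :=
  IsFiniteMeasureOnCompacts.smul _ ENNReal.ofReal_ne_top

lemma integrable_hat {x : L2Half} (hx : x ∈ compactlySupported ℂ halfMeasure) (μ : ℝ)
    (i : Fin 2) : Integrable (fun t => star (psi t μ i) * x t) halfMeasure :=
  integrable_mul_of_compactlySupported hx
    (fun _ _ ha => (continuousOn_psi_left μ i ha).star) (ContinuousLinearMap.id ℂ ℂ)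

lemma integrable_check {y : ModelSpace}
    (hy : y ∈ compactlySupported (EuclideanSpace ℂ (Fin 2)) modelMeasure) (t : ℝ) :
    Integrable (fun μ => ∑ i, psi t μ i * y μ i) modelMeasure :=
  integrable_finsetSum _ fun i _ => integrable_mul_of_compactlySupported hy
    (fun _ _ _ => (continuous_psi_right t i).continuousOn) (EuclideanSpace.proj i)

/-- The integral `hat` as a linear map on the compactly supported functions. -/
def hatLin : compactlySupported ℂ halfMeasure →ₗ[ℂ] (ℝ → EuclideanSpace ℂ (Fin 2)) where
  toFun x := hat (x : L2Half)
  map_add' x y := by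
    funext μ
    ext i
    simp only [hat, Pi.add_apply, PiLp.add_apply]
    rw [← integral_add (integrable_hat x.2 μ i) (integrable_hat y.2 μ i)]
    refine integral_congr_ae ?_
    filter_upwards [Lp.coeFn_add (x : L2Half) y] with ξ h
    rw [Submodule.coe_add, h, Pi.add_apply, mul_add]
  map_smul' c x := by
    funext μ
    ext i
    simp only [hat, Pi.smul_apply, RingHom.id_apply, PiLp.smul_apply, smul_eq_mul]
    rw [← integral_const_mul c]
    refine integral_congr_ae ?_
    filter_upwards [Lp.coeFn_smul c (x : L2Half)] with ξ h
    rw [Submodule.coe_smul, h, Pi.smul_apply, smul_eq_mul, mul_left_comm]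

/-- The integral `check` as a linear map on the compactly supported functions. -/
def checkLin : compactlySupported (EuclideanSpace ℂ (Fin 2)) modelMeasure →ₗ[ℂ] (ℝ → ℂ) where
  toFun y := check (y : ModelSpace)
  map_add' x y := by
    funext t
    simp only [check, Pi.add_apply]
    rw [← integral_add (integrable_check x.2 t) (integrable_check y.2 t)]
    refine integral_congr_ae ?_
    filter_upwards [Lp.coeFn_add (x : ModelSpace) y] with μ h
    rw [Submodule.coe_add, h, ← Finset.sum_add_distrib]
    simp [mul_add]
  map_smul' c x := by
    funext t
    simp only [check, Pi.smul_apply, RingHom.id_apply, smul_eq_mul]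
    rw [← integral_const_mul c]
    refine integral_congr_ae ?_
    filter_upwards [Lp.coeFn_smul c (x : ModelSpace)] with μ h
    rw [Submodule.coe_smul, h, Finset.mul_sum]
    simp [mul_left_comm]

/-- The operator `U : L²(ℝ⁺) → 𝒦`, `x ↦ x̂`: the continuous extension of the integral `hat` from
the compactly supported functions. -/
def U : L2Half →L[ℂ] ModelSpace :=
  l2Extension modelMeasure (compactlySupported ℂ halfMeasure) hatLin

/-- The operator `U⁻¹ : 𝒦 → L²(ℝ⁺)`, `y ↦ y̌`: the continuous extension of the integral `check`
from the compactly supported functions. (That it inverts `U` is not part of the definition.) -/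
def Uinv : ModelSpace →L[ℂ] L2Half :=
  l2Extension halfMeasure (compactlySupported (EuclideanSpace ℂ (Fin 2)) modelMeasure) checkLin

/-! ### Multiplication operators in the model space -/

/-- The set of all `y ∈ 𝒦` for which `G y ∈ 𝒦`. -/
def mulDomain (G : ℝ → Matrix (Fin 2) (Fin 2) ℂ) : Submodule ℂ ModelSpace where
  carrier := {y | MemLp (fun μ => (G μ).toEuclideanLin (y μ)) 2 modelMeasure}
  add_mem' := by
    intro x y hx hy
    refine (MemLp.add hx hy).ae_eq ?_
    filter_upwards [Lp.coeFn_add x y] with μ h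
    rw [h, Pi.add_apply, Pi.add_apply, map_add]
  zero_mem' := by
    refine (MemLp.zero (ε := EuclideanSpace ℂ (Fin 2))).ae_eq ?_
    filter_upwards [Lp.coeFn_zero (EuclideanSpace ℂ (Fin 2)) 2 modelMeasure] with μ h
    rw [h, Pi.zero_apply, map_zero]
  smul_mem' := by
    intro c x hx
    refine (MemLp.const_smul hx c).ae_eq ?_
    filter_upwards [Lp.coeFn_smul c x] with μ h
    rw [h, Pi.smul_apply, Pi.smul_apply, map_smul]

lemma mem_mulDomain {G : ℝ → Matrix (Fin 2) (Fin 2) ℂ} {y : ModelSpace} :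
    y ∈ mulDomain G ↔ MemLp (fun μ => (G μ).toEuclideanLin (y μ)) 2 modelMeasure := Iff.rfl

/-- The operator `ℳ_G` of multiplication by a matrix function `G`, `(ℳ_G y)(μ) = G(μ) y(μ)`,
with domain the set of all `y ∈ 𝒦` for which `G y ∈ 𝒦`; this is all of `𝒦` when `G` is measurable
and bounded. -/
def mulOp (G : ℝ → Matrix (Fin 2) (Fin 2) ℂ) : ModelSpace →ₗ.[ℂ] ModelSpace where
  domain := mulDomain G
  toFun :=
    { toFun := fun y => MemLp.toLp _ (mem_mulDomain.1 y.2)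
      map_add' := by
        intro x y
        rw [← MemLp.toLp_add]
        refine MemLp.toLp_congr _ _ ?_
        filter_upwards [Lp.coeFn_add (x : ModelSpace) y] with μ h
        rw [Submodule.coe_add, h, Pi.add_apply, Pi.add_apply, map_add]
      map_smul' := by
        intro c x
        rw [RingHom.id_apply, ← MemLp.toLp_const_smul]
        refine MemLp.toLp_congr _ _ ?_
        filter_upwards [Lp.coeFn_smul c (x : ModelSpace)] with μ h
        rw [Submodule.coe_smul, h, Pi.smul_apply, Pi.smul_apply, map_smul] }

/-- `f₊₋(μ) = (2π)^{-1/2} e^{iπ/4 + μπ/2} Γ(1/2 - iμ)`. -/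
def fPlusMinus (μ : ℝ) : ℂ :=
  1 / (Real.sqrt (2 * Real.pi) : ℂ) *
    Complex.exp (Complex.I * Real.pi / 4 + μ * Real.pi / 2) *
      Complex.Gamma (1 / 2 - Complex.I * μ)

/-- `f₋₊(μ) = (2π)^{-1/2} e^{iπ/4 - μπ/2} Γ(1/2 + iμ)`. -/
def fMinusPlus (μ : ℝ) : ℂ :=
  1 / (Real.sqrt (2 * Real.pi) : ℂ) *
    Complex.exp (Complex.I * Real.pi / 4 - μ * Real.pi / 2) *
      Complex.Gamma (1 / 2 + Complex.I * μ)

/-- The matrix function `F(μ)`. -/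
def Fmat (μ : ℝ) : Matrix (Fin 2) (Fin 2) ℂ :=
  !![0, fPlusMinus μ; fMinusPlus μ, 0]

end TruncatedFourier

end

/-! In the logarithmic variable `t = e^u` the functions `ψ(t, μ)` become `e^{-u/2} e^{±iuμ}`. So `U`
is the Fourier transform of `e^{u/2} x(e^u)` on the whole line, with the frequencies `-μ` and `μ`
folded into two components over the half-axis; the integral defining `Uinv` unfolds in the same way.
Plancherel's theorem makes both isometric (`eLpNorm_hat`, `eLpNorm_check`), and Fubini's theorem
makes them adjoint to each other (`inner_U_left`). Two isometries that are mutually adjoint are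
unitary and mutually inverse, so no separate inversion formula is needed.

The matrix `F` comes from the formal identity `(2π)^{-1/2} ∫₀^∞ ξ^{a-1} e^{itξ} dξ = (2π)^{-1/2}
Γ(a) e^{iπa/2} t^{-a}` with `a = 1/2 ± iμ`. Since `t^{-a}` is the other component of `ψ(t, μ)`, `F`
is antidiagonal. The integral does not converge absolutely, so `y̌` is damped by `e^{-εt}`. The
damped integral is a Laplace transform at `r = ε - it`
(`integral_cpow_mul_exp_neg_complex_mul_Ioi`), and `ε → 0` is taken both pointwise and in `L²`
(`truncatedFourier_Uinv_ae_eq`).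

The reflection formula for `Γ` bounds the entries of `F` by 1, so multiplication by `F` is a
contraction and the identity extends from compactly supported `y` by density. The formula for the
adjoint operator follows by taking adjoints. -/

namespace TruncatedFourier

open scoped FourierTransform ENNReal Topology ContDiff ComplexConjugate

/-! ### Plancherel's theorem for integrable functions -/

/-- The Fourier integral of an integrable square integrable function represents its Fourier
transform in `L²`. -/
lemma fourier_toLp_ae_eq {f : ℝ → ℂ} (h1 : Integrable f) (h2 : MemLp f 2) :
    (𝓕 (h2.toLp f) : Lp ℂ 2 (volume : Measure ℝ)) =ᵐ[volume] 𝓕 f := by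
  have hc : Continuous (𝓕 f) :=
    VectorFourier.fourierIntegral_continuous Real.continuous_fourierChar
      (L := innerₗ ℝ) continuous_inner h1
  refine ae_eq_of_integral_contDiff_smul_eq
    ((Lp.memLp _).locallyIntegrable (by norm_num)) hc.locallyIntegrable fun g hg hs => ?_
  let φ : SchwartzMap ℝ ℂ :=
    (hs.comp_left (g := ((↑) : ℝ → ℂ)) Complex.ofReal_zero).toSchwartzMap
      (Complex.ofRealCLM.contDiff.comp hg)
  have hφ : ∀ x, φ x = (g x : ℂ) := fun _ => rfl
  -- Against a test function the `L²` transform moves onto `φ` by its distributional definition, and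
  -- Fubini's theorem (`h4`) moves it back onto the integrable `f`.
  have h3 := congrArg (fun T => T φ) (Lp.fourier_toTemperedDistribution_eq (h2.toLp f))
  simp only [TemperedDistribution.fourier_apply, Lp.toTemperedDistribution_apply] at h3
  have h4 := VectorFourier.integral_fourierIntegral_smul_eq_flip (L := innerₗ ℝ)
    Real.continuous_fourierChar continuous_inner (φ.integrable (μ := volume)) h1
  have h5 : ∫ x, (𝓕 φ) x • (h2.toLp f) x = ∫ x, φ x • 𝓕 f x := by
    rw [flip_innerₗ] at h4
    refine Eq.trans (integral_congr_ae ?_) h4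
    filter_upwards [h2.coeFn_toLp] with x hx
    rw [hx, SchwartzMap.fourier_coe]
    rfl
  rw [h5] at h3
  simpa [hφ] using h3.symm

/-- The integral `∫ e^{isξ} f(ξ) dξ`. -/
noncomputable def phaseIntegral (f : ℝ → ℂ) (s : ℝ) : ℂ :=
  ∫ ξ : ℝ, Complex.exp (Complex.I * s * ξ) * f ξ

lemma phaseIntegral_eq_fourier (f : ℝ → ℂ) (s : ℝ) :
    phaseIntegral f s = 𝓕 f ((-(2 * Real.pi))⁻¹ * s) := by
  rw [Real.fourier_real_eq_integral_exp_smul, phaseIntegral]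
  refine integral_congr_ae (ae_of_all _ fun ξ => ?_)
  simp only [smul_eq_mul]
  congr 2
  have := Real.pi_ne_zero
  push_cast
  field_simp

lemma continuous_phaseIntegral {f : ℝ → ℂ} (hf : Integrable f) : Continuous (phaseIntegral f) := by
  have hc : Continuous (𝓕 f) :=
    VectorFourier.fourierIntegral_continuous Real.continuous_fourierChar
      (L := innerₗ ℝ) continuous_inner hf
  rw [funext (phaseIntegral_eq_fourier f)]
  fun_prop

lemma eLpNorm_two_sq {α E : Type*} [MeasurableSpace α] [NormedAddCommGroup E] (μ : Measure α)
    (f : α → E) : eLpNorm f 2 μ ^ 2 = ∫⁻ x, ‖f x‖ₑ ^ 2 ∂μ := by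
  have := eLpNorm_nnreal_pow_eq_lintegral (μ := μ) (f := f) (p := 2) two_ne_zero
  simpa only [NNReal.coe_ofNat, ENNReal.coe_ofNat, ENNReal.rpow_ofNat] using this

/-- Plancherel's theorem. -/
lemma lintegral_phaseIntegral {f : ℝ → ℂ} (h1 : Integrable f) (h2 : MemLp f 2) :
    ∫⁻ s, ‖phaseIntegral f s‖ₑ ^ 2 = ENNReal.ofReal (2 * Real.pi) * ∫⁻ ξ, ‖f ξ‖ₑ ^ 2 := by
  have h0 : (-(2 * Real.pi))⁻¹ ≠ 0 := inv_ne_zero (neg_ne_zero.2 Real.two_pi_pos.ne')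
  have h3 : ∫⁻ w, ‖𝓕 f w‖ₑ ^ 2 = ∫⁻ ξ, ‖f ξ‖ₑ ^ 2 := by
    rw [← eLpNorm_two_sq, ← eLpNorm_two_sq, ← eLpNorm_congr_ae (fourier_toLp_ae_eq h1 h2),
      ← eLpNorm_congr_ae h2.coeFn_toLp, ← Lp.enorm_def, ← Lp.enorm_def,
      ← ofReal_norm, ← ofReal_norm, Lp.norm_fourier_eq]
  simp_rw [phaseIntegral_eq_fourier]
  -- The kernel of `𝓕` is `e^{-2πiwξ}`, hence `w = -s/(2π)`; the Jacobian of this substitution is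
  -- the factor `2π`.
  rw [← h3, ← (measurableEmbedding_mulLeft₀ h0).lintegral_map (fun w => ‖𝓕 f w‖ₑ ^ 2),
    Real.map_volume_mul_left h0, lintegral_smul_measure]
  congr 2
  rw [inv_inv, abs_neg, abs_of_pos Real.two_pi_pos]

/-! ### Dominated convergence in `L²` and extensions by continuity -/

/-- The limit serves as its own majorant: `‖f n - g‖² ≤ (2‖g‖)²`, and dominated convergence applies
to the squares. -/
lemma tendsto_toLp_of_dominated {α E : Type*} [MeasurableSpace α] [NormedAddCommGroup E]
    {ν : Measure α} {f : ℕ → α → E} {g : α → E} (hf : ∀ n, MemLp (f n) 2 ν) (hg : MemLp g 2 ν)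
    (hb : ∀ n, ∀ᵐ x ∂ν, ‖f n x‖ ≤ ‖g x‖)
    (hl : ∀ᵐ x ∂ν, Tendsto (fun n => f n x) atTop (𝓝 (g x))) :
    Tendsto (fun n => (hf n).toLp (f n)) atTop (𝓝 (hg.toLp g)) := by
  rw [Lp.tendsto_Lp_iff_tendsto_eLpNorm'']
  have h : Tendsto (fun n => ∫⁻ x, ‖(f n - g) x‖ₑ ^ 2 ∂ν) atTop (𝓝 (∫⁻ _, 0 ∂ν)) := by
    refine tendsto_lintegral_of_dominated_convergence' (fun x => (2 * ‖g x‖ₑ) ^ 2)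
      (fun n => ((hf n).sub hg).1.enorm.pow_const 2) (fun n => ?_) ?_ ?_
    · filter_upwards [hb n] with x hx
      gcongr
      refine (enorm_sub_le).trans ?_
      rw [two_mul]
      gcongr
      exact enorm_le_iff_norm_le.2 hx
    · simp_rw [mul_pow]
      rw [lintegral_const_mul' _ _ (by simp), ← eLpNorm_two_sq]
      exact ENNReal.mul_ne_top (by simp) (by simpa using hg.2.ne)
    · filter_upwards [hl] with x hx
      have : Tendsto (fun n => ‖f n x - g x‖ₑ ^ 2) atTop (𝓝 (‖(0 : E)‖ₑ ^ 2)) := by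
        refine ENNReal.Tendsto.pow ?_
        exact (continuous_enorm.tendsto _).comp (by simpa using hx.sub_const (g x))
      simpa using this
  simp only [lintegral_zero, ← eLpNorm_two_sq] at h
  have h2 := h.ennrpow_const (1 / 2 : ℝ)
  simp only [← ENNReal.rpow_two, ← ENNReal.rpow_mul] at h2
  simpa using h2

section Extension

variable {E F : Type*} [NormedAddCommGroup E] [NormedSpace ℂ E]
  [NormedAddCommGroup F] [NormedSpace ℂ F] {ν ν' : Measure ℝ}

/-- Cutting off to `[1/(n+1), n+1]` converges in `L²` by domination; these intervals exhaust `(0,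
∞)`, which carries `ν`. -/
lemma dense_compactlySupported (hν : ∀ᵐ t ∂ν, 0 < t) :
    Dense (compactlySupported E ν : Set (Lp E 2 ν)) := by
  intro x
  let s : ℕ → Set ℝ := fun n => Icc ((n : ℝ) + 1)⁻¹ (n + 1)
  have hm : ∀ n, MemLp ((s n).indicator x) 2 ν := fun n => (Lp.memLp x).indicator measurableSet_Icc
  have hx : Tendsto (fun n => (hm n).toLp _) atTop (𝓝 ((Lp.memLp x).toLp x)) := by
    refine tendsto_toLp_of_dominated hm _
      (fun n => ae_of_all _ fun t => norm_indicator_le_norm_self _ _) ?_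
    filter_upwards [hν] with t ht
    refine tendsto_const_nhds.congr' ?_
    obtain ⟨N, hN⟩ := exists_nat_ge (max t t⁻¹)
    filter_upwards [eventually_ge_atTop N] with n hn
    have hn' : (N : ℝ) ≤ n := by exact_mod_cast hn
    have h1 := (le_max_left _ _).trans hN
    have h2 := (le_max_right _ _).trans hN
    rw [indicator_of_mem]
    exact ⟨inv_le_of_inv_le₀ ht (by linarith), by linarith⟩
  rw [Lp.toLp_coeFn] at hx
  refine mem_closure_of_tendsto hx (Eventually.of_forall fun n => ?_)
  refine ⟨((n : ℝ) + 1)⁻¹, n + 1, by positivity, ?_⟩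
  filter_upwards [(hm n).coeFn_toLp] with t h1 h2
  rw [h1, indicator_of_notMem h2]

lemma compactlySupported_le_integrableFunctions [IsFiniteMeasureOnCompacts ν] :
    compactlySupported ℂ ν ≤ integrableFunctions ℂ ν := fun x hx => by
  simpa using! integrable_mul_of_compactlySupported hx (k := fun _ => 1)
    (fun _ _ _ => continuousOn_const) (ContinuousLinearMap.id ℂ ℂ)

/-- The bound on the norms makes `squareDomain` all of `D`. So the map to be extended has dense
domain and norm at most 1, which is what `extendOfNorm` needs in order to be a genuine extension. -/
lemma l2Extension_ae_eq [CompleteSpace F] {D : Submodule ℂ (Lp E 2 ν)} {T : D →ₗ[ℂ] (ℝ → F)}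
    (hD : Dense (D : Set (Lp E 2 ν))) (hm : ∀ x, AEStronglyMeasurable (T x) ν')
    (hT : ∀ x, eLpNorm (T x) 2 ν' ≤ eLpNorm (x : Lp E 2 ν) 2 ν) (x : D) :
    l2Extension ν' D T x =ᵐ[ν'] T x := by
  have hL : ∀ x, MemLp (T x) 2 ν' := fun x => ⟨hm x, (hT x).trans_lt (Lp.memLp _).2⟩
  have h := LinearMap.extendOfNorm_eq (f := squareMap ν' D T)
    (e := D.subtype ∘ₗ (squareDomain ν' D T).subtype) ?_ ⟨1, fun y => ?_⟩ ⟨x, hL x⟩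
  · have h' : l2Extension ν' D T x = (hL x).toLp (T x) := h
    rw [h']
    exact (hL x).coeFn_toLp
  · refine hD.mono fun y hy => ⟨⟨⟨y, hy⟩, hL _⟩, rfl⟩
  · rw [one_mul]
    change ‖(hL y.1).toLp (T y.1)‖ ≤ ‖(y.1 : Lp E 2 ν)‖
    rw [Lp.norm_toLp, Lp.norm_def]
    exact ENNReal.toReal_mono (Lp.memLp _).2.ne (hT y)

end Extension

/-! ### The Laplace transform of a power -/

lemma integrableOn_cpow_mul_exp_neg_mul {a r : ℂ} (ha : 0 < a.re) (hr : 0 < r.re) :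
    IntegrableOn (fun t : ℝ => (t : ℂ) ^ (a - 1) * Complex.exp (-(r * t))) (Ioi 0) := by
  have h := integrableOn_rpow_mul_exp_neg_mul_rpow (s := a.re - 1) (by linarith) one_pos hr
  refine h.mono' (ContinuousOn.aestronglyMeasurable (fun t ht => ContinuousAt.continuousWithinAt ?_)
    measurableSet_Ioi) ?_
  · refine ContinuousAt.mul (ContinuousAt.cpow Complex.continuous_ofReal.continuousAt
      continuousAt_const (Complex.ofReal_mem_slitPlane.2 ht)) (by fun_prop)
  · filter_upwards [ae_restrict_mem measurableSet_Ioi] with t ht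
    rw [norm_mul, Complex.norm_cpow_eq_rpow_re_of_pos ht, Complex.norm_exp]
    simp

/-- Both sides are holomorphic in `r` on the right half-plane and agree for real `r > 0`, so the
identity theorem gives equality. -/
lemma integral_cpow_mul_exp_neg_complex_mul_Ioi {a r : ℂ} (ha : 0 < a.re) (hr : 0 < r.re) :
    ∫ t : ℝ in Ioi 0, (t : ℂ) ^ (a - 1) * Complex.exp (-(r * t)) =
      (1 / r) ^ a * Complex.Gamma a := by
  have ho : IsOpen {z : ℂ | 0 < z.re} := isOpen_lt continuous_const Complex.continuous_re
  have h1 : DifferentiableOn ℂ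
      (fun r : ℂ => ∫ t : ℝ in Ioi 0, (t : ℂ) ^ (a - 1) * Complex.exp (-(r * t)))
      {z : ℂ | 0 < z.re} := by
    intro z (hz : 0 < z.re)
    have hs : {w : ℂ | z.re / 2 < w.re} ∈ 𝓝 z :=
      (isOpen_lt continuous_const Complex.continuous_re).mem_nhds (by simpa using hz)
    have hm : ∀ w : ℂ, 0 < w.re → AEStronglyMeasurable
        (fun t : ℝ => (t : ℂ) ^ (a - 1) * Complex.exp (-(w * t))) (volume.restrict (Ioi 0)) :=
      fun w hw => (integrableOn_cpow_mul_exp_neg_mul ha hw).1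
    refine (hasDerivAt_integral_of_dominated_loc_of_deriv_le hs (μ := volume.restrict (Ioi 0))
      (F := fun w t => (t : ℂ) ^ (a - 1) * Complex.exp (-(w * t)))
      (F' := fun w t => (t : ℂ) ^ (a - 1) * Complex.exp (-(w * t)) * (-t))
      -- On the neighbourhood `Re w > Re z / 2` the exponential is at most `e^{-(Re z/2)t}`;
      -- differentiating in `w` raises the power `t^{Re a - 1}` to `t^{Re a}`.
      (bound := fun t : ℝ => t ^ a.re * Real.exp (-(z.re / 2) * t ^ (1 : ℝ))) ?_
      (integrableOn_cpow_mul_exp_neg_mul ha hz) ?_ ?_ ?_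
      ?_).2.differentiableAt.differentiableWithinAt
    · filter_upwards [ho.mem_nhds hz] with w hw using hm w hw
    · exact (hm z hz).mul (by fun_prop)
    · filter_upwards [ae_restrict_mem measurableSet_Ioi] with t ht w hw
      have ht' : (0 : ℝ) < t := ht
      rw [norm_mul, norm_mul, Complex.norm_cpow_eq_rpow_re_of_pos ht, Complex.norm_exp]
      have e : t ^ a.re = t ^ (a - 1).re * t := by
        rw [Complex.sub_re, Complex.one_re, Real.rpow_sub_one ht'.ne', div_mul_cancel₀ _ ht'.ne']
      rw [e, norm_neg, Complex.norm_real, Real.norm_of_nonneg ht'.le, mul_right_comm]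
      gcongr
      simp only [Complex.neg_re, Complex.mul_re, Complex.ofReal_re, Complex.ofReal_im, mul_zero,
        sub_zero, Real.rpow_one, neg_mul, neg_le_neg_iff]
      exact mul_le_mul_of_nonneg_right (le_of_lt hw) ht'.le
    · exact integrableOn_rpow_mul_exp_neg_mul_rpow (by linarith) one_pos (by linarith)
    · refine ae_of_all _ fun t w _ => ?_
      have := ((((hasDerivAt_id w).mul_const (t : ℂ)).neg).cexp).const_mul ((t : ℂ) ^ (a - 1))
      simpa [mul_assoc] using this
  have h2 : DifferentiableOn ℂ (fun r : ℂ => (1 / r) ^ a * Complex.Gamma a) {z : ℂ | 0 < z.re} := by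
    intro z (hz : 0 < z.re)
    have hz0 : z ≠ 0 := by rintro rfl; simp at hz
    have h3 : 1 / z ∈ Complex.slitPlane := by
      refine Or.inl ?_
      rw [one_div, Complex.inv_re]
      exact div_pos hz (Complex.normSq_pos.2 hz0)
    have h4 : DifferentiableAt ℂ (fun r : ℂ => 1 / r) z := by
      simpa using differentiableAt_inv hz0
    exact ((h4.cpow_const h3).mul_const _).differentiableWithinAt
  have hfreq : ∃ᶠ z : ℂ in 𝓝[≠] 1, (∫ t : ℝ in Ioi 0, (t : ℂ) ^ (a - 1) * Complex.exp (-(z * t))) =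
      (1 / z) ^ a * Complex.Gamma a := by
    have ht : Tendsto ((↑) : ℝ → ℂ) (𝓝[≠] 1) (𝓝[≠] 1) := by
      refine tendsto_nhdsWithin_iff.2 ⟨?_, ?_⟩
      · exact (Complex.continuous_ofReal.tendsto' 1 1 Complex.ofReal_one).mono_left
          nhdsWithin_le_nhds
      · filter_upwards [self_mem_nhdsWithin] with t ht
        simpa using ht
    refine ht.frequently (Eventually.frequently ?_)
    filter_upwards [nhdsWithin_le_nhds (Ioi_mem_nhds (zero_lt_one' ℝ))] with t ht
    exact Complex.integral_cpow_mul_exp_neg_mul_Ioi ha ht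
  exact AnalyticOnNhd.eqOn_of_preconnected_of_frequently_eq (h1.analyticOnNhd ho)
    (h2.analyticOnNhd ho) (convex_halfSpace_re_gt 0).isPreconnected
    (by simp : (1 : ℂ) ∈ {z : ℂ | 0 < z.re}) hfreq hr

/-! ### The truncated Fourier operator and its adjoint -/

lemma ae_halfMeasure_pos : ∀ᵐ t ∂halfMeasure, 0 < t := ae_restrict_mem measurableSet_Ioi

lemma ae_modelMeasure_pos : ∀ᵐ t ∂modelMeasure, 0 < t :=
  Measure.ae_smul_measure ae_halfMeasure_pos _

lemma dense_integrableFunctions :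
    Dense (integrableFunctions ℂ halfMeasure : Set L2Half) :=
  (dense_compactlySupported ae_halfMeasure_pos).mono
    compactlySupported_le_integrableFunctions

lemma phaseIntegral_indicator (f : ℝ → ℂ) (s : ℝ) :
    phaseIntegral ((Ioi 0).indicator f) s =
      ∫ ξ in Ioi (0 : ℝ), Complex.exp (Complex.I * s * ξ) * f ξ := by
  rw [phaseIntegral, ← integral_indicator measurableSet_Ioi]
  refine integral_congr_ae (ae_of_all _ fun ξ => ?_)
  by_cases h : ξ ∈ Ioi (0 : ℝ) <;> simp [h]

lemma enorm_sqrt_two_pi_inv_sq :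
    ‖1 / (Real.sqrt (2 * Real.pi) : ℂ)‖ₑ ^ 2 = (ENNReal.ofReal (2 * Real.pi))⁻¹ := by
  rw [← ofReal_norm, ← ENNReal.ofReal_pow (norm_nonneg _), norm_div, norm_one, Complex.norm_real,
    Real.norm_of_nonneg (Real.sqrt_nonneg _), div_pow, Real.sq_sqrt Real.two_pi_pos.le, one_pow,
    one_div, ENNReal.ofReal_inv_of_pos Real.two_pi_pos]

/-- Plancherel's theorem for `x` extended by zero. The left side runs over all real `t`; restricting
it to `t > 0` is what makes the truncated operator only a contraction. -/
lemma lintegral_fourierIntegral {x : ℝ → ℂ} (h1 : Integrable x halfMeasure)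
    (h2 : MemLp x 2 halfMeasure) :
    ∫⁻ t, ‖fourierIntegral x t‖ₑ ^ 2 = ∫⁻ t, ‖x t‖ₑ ^ 2 ∂halfMeasure := by
  have h1' : Integrable ((Ioi 0).indicator x) := (integrable_indicator_iff measurableSet_Ioi).2 h1
  have h2' : MemLp ((Ioi 0).indicator x) 2 := (memLp_indicator_iff_restrict measurableSet_Ioi).2 h2
  have e : ∀ t, ‖fourierIntegral x t‖ₑ ^ 2 = (ENNReal.ofReal (2 * Real.pi))⁻¹ *
      ‖phaseIntegral ((Ioi 0).indicator x) t‖ₑ ^ 2 := fun t => by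
    rw [fourierIntegral, phaseIntegral_indicator, enorm_mul, mul_pow, enorm_sqrt_two_pi_inv_sq]
  have hp : ENNReal.ofReal (2 * Real.pi) ≠ 0 := (ENNReal.ofReal_pos.2 Real.two_pi_pos).ne'
  simp_rw [e]
  rw [lintegral_const_mul' _ _ (ENNReal.inv_ne_top.2 hp), lintegral_phaseIntegral h1' h2',
    ← mul_assoc, ENNReal.inv_mul_cancel hp ENNReal.ofReal_ne_top, one_mul,
    ← lintegral_indicator measurableSet_Ioi]
  refine lintegral_congr fun t => ?_
  by_cases h : t ∈ Ioi (0 : ℝ) <;> simp [h]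

lemma continuous_fourierIntegral {x : ℝ → ℂ} (h1 : Integrable x halfMeasure) :
    Continuous (fourierIntegral x) := by
  have h := continuous_phaseIntegral ((integrable_indicator_iff measurableSet_Ioi).2 h1)
  rw [funext (phaseIntegral_indicator x)] at h
  exact continuous_const.mul h

lemma lintegral_comp_neg_real (f : ℝ → ℝ≥0∞) : ∫⁻ t, f (-t) = ∫⁻ t, f t :=
  (Measure.measurePreserving_neg (volume : Measure ℝ)).lintegral_comp_emb
    (MeasurableEquiv.neg ℝ).measurableEmbedding f

lemma eLpNorm_fourierIntegral_le {x : ℝ → ℂ} (h1 : Integrable x halfMeasure)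
    (h2 : MemLp x 2 halfMeasure) :
    eLpNorm (fourierIntegral x) 2 halfMeasure ≤ eLpNorm x 2 halfMeasure := by
  rw [← ENNReal.pow_le_pow_left_iff two_ne_zero, eLpNorm_two_sq, eLpNorm_two_sq,
    ← lintegral_fourierIntegral h1 h2]
  exact lintegral_mono' Measure.restrict_le_self le_rfl

lemma truncatedFourier_ae_eq {x : L2Half} (hx : Integrable x halfMeasure) :
    truncatedFourier x =ᵐ[halfMeasure] fourierIntegral x := by
  have hm (y : integrableFunctions ℂ halfMeasure) :
      AEStronglyMeasurable (fourierLin y) halfMeasure :=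
    (continuous_fourierIntegral y.2).aestronglyMeasurable
  have hn (y : integrableFunctions ℂ halfMeasure) :
      eLpNorm (fourierLin y) 2 halfMeasure ≤ eLpNorm (y : L2Half) 2 halfMeasure :=
    eLpNorm_fourierIntegral_le y.2 (Lp.memLp _)
  exact l2Extension_ae_eq dense_integrableFunctions hm hn ⟨x, hx⟩

lemma memLp_fourierIntegral_neg {x : ℝ → ℂ} (h1 : Integrable x halfMeasure)
    (h2 : MemLp x 2 halfMeasure) : MemLp (fun t => fourierIntegral x (-t)) 2 halfMeasure := by
  refine ⟨((continuous_fourierIntegral h1).comp continuous_neg).aestronglyMeasurable, ?_⟩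
  refine (ENNReal.pow_lt_top_iff.1 ?_).resolve_right two_ne_zero
  rw [eLpNorm_two_sq]
  refine (lintegral_mono' Measure.restrict_le_self le_rfl).trans_lt ?_
  · rw [lintegral_comp_neg_real (fun t => ‖fourierIntegral x t‖ₑ ^ 2),
      lintegral_fourierIntegral h1 h2, ← eLpNorm_two_sq]
    exact ENNReal.pow_lt_top h2.2

/-- Fubini's theorem: the kernel is symmetric in `t` and `ξ`, and conjugating it reverses the sign
of the exponent. -/
lemma inner_fourierIntegral {x z : ℝ → ℂ} (hx : Integrable x halfMeasure)
    (hz : Integrable z halfMeasure) :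
    ∫ t, inner ℂ (fourierIntegral x t) (z t) ∂halfMeasure =
      ∫ ξ, inner ℂ (x ξ) (fourierIntegral z (-ξ)) ∂halfMeasure := by
  simp only [fourierIntegral, RCLike.inner_apply, map_mul, ← integral_conj, ← Complex.exp_conj,
    ← integral_const_mul, ← integral_mul_const]
  rw [integral_integral_swap]
  · refine integral_congr_ae (ae_of_all _ fun ξ => integral_congr_ae (ae_of_all _ fun t => ?_))
    simp
    ring_nf
  · have h : Integrable (fun p : ℝ × ℝ => z p.1 * (starRingEnd ℂ) (x p.2))
        (halfMeasure.prod halfMeasure) := hz.mul_prod (Complex.conjLIE.integrable_comp_iff.2 hx)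
    have := (h.bdd_mul (c := 1) (f := fun p : ℝ × ℝ => Complex.exp (-(Complex.I * p.1 * p.2)))
      (by fun_prop) (ae_of_all _ fun p => by simp [Complex.norm_exp])).const_mul
        (1 / (Real.sqrt (2 * Real.pi) : ℂ))
    refine this.congr (ae_of_all _ fun p => ?_)
    simp [Function.uncurry]
    ring

lemma adjoint_truncatedFourier_ae_eq {x : L2Half} (hx : Integrable x halfMeasure) :
    truncatedFourier.adjoint x =ᵐ[halfMeasure] fun t => fourierIntegral x (-t) := by
  have hm := memLp_fourierIntegral_neg hx (Lp.memLp x)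
  have h : truncatedFourier.adjoint x = hm.toLp _ := by
    refine dense_integrableFunctions.eq_of_inner_right (𝕜 := ℂ) fun z hz => ?_
    rw [ContinuousLinearMap.adjoint_inner_right, L2.inner_def, L2.inner_def]
    refine Eq.trans (integral_congr_ae ?_)
      ((inner_fourierIntegral hz hx).trans (integral_congr_ae ?_))
    · filter_upwards [truncatedFourier_ae_eq hz] with t ht
      rw [ht]
    · filter_upwards [hm.coeFn_toLp] with t ht
      rw [ht]
  rw [h]
  exact hm.coeFn_toLp

/-! ### The row `ψ` and changes of variables -/

/-- The sign of the exponent `iμ` in the components of `ψ(t, μ)`. -/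
noncomputable def psiSign : Fin 2 → ℝ := ![1, -1]

lemma psi_eq_cpow (t μ : ℝ) (i : Fin 2) :
    psi t μ i = (t : ℂ) ^ (-1 / 2 + Complex.I * (psiSign i * μ : ℝ)) := by
  fin_cases i <;> simp [psi, psiSign, sub_eq_add_neg]

lemma psi_exp (u μ : ℝ) (i : Fin 2) :
    psi (Real.exp u) μ i =
      Complex.exp (-u / 2) * Complex.exp (Complex.I * (psiSign i * u : ℝ) * μ) := by
  rw [psi_eq_cpow, Complex.cpow_def_of_ne_zero (by simp), ← Complex.ofReal_log (Real.exp_pos u).le,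
    Real.log_exp, ← Complex.exp_add]
  congr 1
  push_cast
  ring

lemma norm_psi {t : ℝ} (ht : 0 < t) (μ : ℝ) (i : Fin 2) : ‖psi t μ i‖ = t ^ (-1 / 2 : ℝ) := by
  rw [psi_eq_cpow, Complex.norm_cpow_eq_rpow_re_of_pos ht]
  norm_num

lemma measurable_psi (i : Fin 2) : Measurable fun p : ℝ × ℝ => psi p.1 p.2 i := by
  simp_rw [psi_eq_cpow]
  fun_prop

lemma lintegral_halfMeasure_eq (h : ℝ → ℝ≥0∞) :
    ∫⁻ t, h t ∂halfMeasure = ∫⁻ u, ENNReal.ofReal (Real.exp u) * h (Real.exp u) := by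
  rw [halfMeasure, ← Real.range_exp, ← image_univ, lintegral_image_eq_lintegral_abs_deriv_mul
    MeasurableSet.univ (fun u _ => (Real.hasDerivAt_exp u).hasDerivWithinAt)
    Real.exp_injective.injOn, Measure.restrict_univ]
  simp_rw [abs_of_pos (Real.exp_pos _)]

lemma integral_halfMeasure_eq (h : ℝ → ℂ) :
    ∫ t, h t ∂halfMeasure = ∫ u, (Real.exp u : ℂ) * h (Real.exp u) := by
  rw [halfMeasure, ← Real.range_exp, ← image_univ, integral_image_eq_integral_abs_deriv_smul
    MeasurableSet.univ (fun u _ => (Real.hasDerivAt_exp u).hasDerivWithinAt)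
    Real.exp_injective.injOn, Measure.restrict_univ]
  simp_rw [abs_of_pos (Real.exp_pos _), Complex.real_smul]

lemma integrable_halfMeasure_iff (h : ℝ → ℂ) :
    Integrable h halfMeasure ↔ Integrable fun u => (Real.exp u : ℂ) * h (Real.exp u) := by
  change IntegrableOn h (Ioi 0) ↔ _
  rw [← Real.range_exp, ← image_univ, integrableOn_image_iff_integrableOn_abs_deriv_smul
    MeasurableSet.univ (fun u _ => (Real.hasDerivAt_exp u).hasDerivWithinAt)
    Real.exp_injective.injOn, integrableOn_univ]
  simp_rw [abs_of_pos (Real.exp_pos _), Complex.real_smul]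

/-- Folds the line onto the half-axis, pairing `t` with `-t`; this turns two components on `(0, ∞)`
into one function on `ℝ`. -/
lemma lintegral_halfMeasure_add_neg {f : ℝ → ℝ≥0∞} (hf : Measurable f) :
    ∫⁻ t, (f t + f (-t)) ∂halfMeasure = ∫⁻ t, f t := by
  have h : ∫⁻ t in Ioi 0, f (-t) = ∫⁻ t in Iio 0, f t := by
    have := (Measure.measurePreserving_neg (volume : Measure ℝ)).setLIntegral_comp_preimage_emb
      (MeasurableEquiv.neg ℝ).measurableEmbedding f (Iio 0)
    simpa using this
  rw [lintegral_add_left hf, h, setLIntegral_congr Iio_ae_eq_Iic, ← compl_Ioi,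
    lintegral_add_compl f measurableSet_Ioi]

lemma integral_halfMeasure_add_neg {f : ℝ → ℂ} (hf : Integrable f) :
    ∫ t, (f t + f (-t)) ∂halfMeasure = ∫ t, f t := by
  rw [integral_add hf.integrableOn hf.comp_neg.integrableOn, integral_comp_neg_Ioi, neg_zero,
    ← compl_Ioi, integral_add_compl measurableSet_Ioi hf]

lemma enorm_sq_euclidean (v : EuclideanSpace ℂ (Fin 2)) :
    ‖v‖ₑ ^ 2 = ‖v 0‖ₑ ^ 2 + ‖v 1‖ₑ ^ 2 := by
  simp_rw [← ofReal_norm, ← ENNReal.ofReal_pow (norm_nonneg _)]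
  rw [← ENNReal.ofReal_add (by positivity) (by positivity), EuclideanSpace.norm_sq_eq,
    Fin.sum_univ_two]

lemma ofReal_exp_mul_enorm_sq (u : ℝ) (z : ℂ) :
    ENNReal.ofReal (Real.exp u) * ‖Complex.exp (-u / 2) * z‖ₑ ^ 2 = ‖z‖ₑ ^ 2 := by
  rw [enorm_mul, mul_pow, ← mul_assoc, ← ofReal_norm, Complex.norm_exp,
    ← ENNReal.ofReal_pow (by positivity), ← ENNReal.ofReal_mul (by positivity), ← Real.exp_nat_mul,
    ← Real.exp_add]
  have : u + (2 : ℕ) * (-(u : ℂ) / 2).re = 0 := by simp; ring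
  rw [this, Real.exp_zero, ENNReal.ofReal_one, one_mul]

lemma modelFactor_mul : ENNReal.ofReal (1 / (2 * Real.pi)) * ENNReal.ofReal (2 * Real.pi) = 1 := by
  have := Real.two_pi_pos
  rw [← ENNReal.ofReal_mul (by positivity), one_div, inv_mul_cancel₀ this.ne', ENNReal.ofReal_one]

lemma lintegral_modelMeasure (h : ℝ → ℝ≥0∞) :
    ∫⁻ μ, h μ ∂modelMeasure = ENNReal.ofReal (1 / (2 * Real.pi)) * ∫⁻ μ, h μ ∂halfMeasure :=
  lintegral_smul_measure _ _

lemma integral_modelMeasure (h : ℝ → ℂ) :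
    ∫ μ, h μ ∂modelMeasure = 1 / (2 * Real.pi) * ∫ μ, h μ ∂halfMeasure := by
  have := Real.two_pi_pos
  rw [integral_smul_measure, ENNReal.toReal_ofReal (by positivity), Complex.real_smul]
  push_cast
  rfl

lemma integrable_modelMeasure_iff {E : Type*} [NormedAddCommGroup E] (h : ℝ → E) :
    Integrable h modelMeasure ↔ Integrable h halfMeasure :=
  integrable_smul_measure (by simpa using Real.pi_pos) ENNReal.ofReal_ne_top

/-! ### Isometry on the compactly supported functions -/

lemma continuousOn_rpow_ofReal (s : ℝ) {a b : ℝ} (ha : 0 < a) :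
    ContinuousOn (fun t : ℝ => ((t ^ s : ℝ) : ℂ)) (Icc a b) := fun t ht =>
  (Complex.continuous_ofReal.continuousAt.comp
    (Real.continuousAt_rpow_const t s (Or.inl (ha.trans_le ht.1).ne'))).continuousWithinAt

/-- The function `u ↦ e^{u/2} x(e^u)`. -/
noncomputable def logPullback (x : ℝ → ℂ) (u : ℝ) : ℂ := Complex.exp (u / 2) * x (Real.exp u)

/-- The Jacobian `e^u` times the factor `e^{-u/2}` of `ψ` gives the weight `e^{u/2}` of
`logPullback`; what remains of the conjugated `ψ` is a character. -/
lemma hat_apply (x : ℝ → ℂ) (μ : ℝ) (i : Fin 2) :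
    hat x μ i = phaseIntegral (logPullback x) (-(psiSign i * μ)) := by
  rw [hat, PiLp.toLp_apply, integral_halfMeasure_eq, phaseIntegral]
  refine integral_congr_ae (ae_of_all _ fun u => ?_)
  simp only [psi_exp, logPullback, Complex.ofReal_exp, star_mul', ← mul_assoc]
  congr 1
  simp only [RCLike.star_def, ← Complex.exp_conj, ← Complex.exp_add]
  congr 1
  simp [map_ofNat]
  ring

lemma integrable_logPullback {x : L2Half} (hx : x ∈ compactlySupported ℂ halfMeasure) :
    Integrable (logPullback x) := by
  have h := (integrable_halfMeasure_iff _).1 <| integrable_mul_of_compactlySupported hx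
    (k := fun t : ℝ => ((t ^ (-1 / 2 : ℝ) : ℝ) : ℂ))
    (fun _ _ ha => continuousOn_rpow_ofReal _ ha) (ContinuousLinearMap.id ℂ ℂ)
  refine h.congr (ae_of_all _ fun u => ?_)
  simp only [logPullback, ← Real.exp_mul, ContinuousLinearMap.id_apply, ← mul_assoc,
    ← Complex.ofReal_mul, ← Real.exp_add]
  congr 1
  push_cast
  congr 1
  ring

lemma lintegral_logPullback (x : ℝ → ℂ) :
    ∫⁻ u, ‖logPullback x u‖ₑ ^ 2 = ∫⁻ t, ‖x t‖ₑ ^ 2 ∂halfMeasure := by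
  rw [lintegral_halfMeasure_eq]
  refine lintegral_congr fun u => ?_
  rw [← ofReal_exp_mul_enorm_sq u, logPullback, ← mul_assoc, ← Complex.exp_add]
  simp [neg_div]

lemma memLp_logPullback (x : L2Half) : MemLp (logPullback x) 2 := by
  have h1 : StronglyMeasurable (logPullback x) :=
    (by fun_prop : Continuous fun u : ℝ => Complex.exp (u / 2)).stronglyMeasurable.mul
      ((Lp.stronglyMeasurable x).comp_measurable Real.measurable_exp)
  refine ⟨h1.aestronglyMeasurable, (ENNReal.pow_lt_top_iff.1 ?_).resolve_right two_ne_zero⟩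
  rw [eLpNorm_two_sq, lintegral_logPullback, ← eLpNorm_two_sq]
  exact ENNReal.pow_lt_top (Lp.memLp x).2

lemma continuous_hat {x : L2Half} (hx : x ∈ compactlySupported ℂ halfMeasure) :
    Continuous (hat x) := by
  have h := continuous_phaseIntegral (integrable_logPullback hx)
  have e : hat x = fun μ => WithLp.toLp 2
      fun i => phaseIntegral (logPullback x) (-(psiSign i * μ)) := by
    funext μ
    ext i
    exact hat_apply _ _ _
  rw [e]
  fun_prop

/-- The two components are one Fourier transform at `-μ` and `μ`, so together they fill the line;
the weight `1/(2π)` of the model measure cancels the constant of Plancherel's theorem. -/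
lemma eLpNorm_hat {x : L2Half} (hx : x ∈ compactlySupported ℂ halfMeasure) :
    eLpNorm (hat x) 2 modelMeasure = eLpNorm x 2 halfMeasure := by
  refine (ENNReal.pow_right_strictMono two_ne_zero).injective ?_
  rw [eLpNorm_two_sq, eLpNorm_two_sq, lintegral_modelMeasure]
  have hc := continuous_phaseIntegral (integrable_logPullback hx)
  have e : ∀ μ, ‖hat x μ‖ₑ ^ 2 = (fun μ => ‖phaseIntegral (logPullback x) μ‖ₑ ^ 2) μ +
      (fun μ => ‖phaseIntegral (logPullback x) μ‖ₑ ^ 2) (-μ) := fun μ => by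
    rw [enorm_sq_euclidean, hat_apply, hat_apply, add_comm]
    simp [psiSign]
  simp_rw [e]
  rw [lintegral_halfMeasure_add_neg (f := fun μ => ‖phaseIntegral (logPullback x) μ‖ₑ ^ 2)
    (by fun_prop), lintegral_phaseIntegral (integrable_logPullback hx) (memLp_logPullback x),
    ← mul_assoc, modelFactor_mul, one_mul, lintegral_logPullback]

/-- The function on the axis with the values `y⁺(μ)` at `μ > 0` and `y⁻(-μ)` at `μ ≤ 0`. -/
noncomputable def unfold (y : ℝ → EuclideanSpace ℂ (Fin 2)) (μ : ℝ) : ℂ :=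
  if 0 < μ then y μ 0 else y (-μ) 1

lemma unfold_pos (y : ℝ → EuclideanSpace ℂ (Fin 2)) {μ : ℝ} (h : 0 < μ) :
    unfold y μ = y μ 0 := if_pos h

lemma unfold_neg (y : ℝ → EuclideanSpace ℂ (Fin 2)) {μ : ℝ} (h : 0 < μ) :
    unfold y (-μ) = y μ 1 := by
  rw [unfold, if_neg (by linarith), neg_neg]

lemma measurable_unfold (y : ModelSpace) : Measurable (unfold y) := by
  have hy : Measurable y := (Lp.stronglyMeasurable y).measurable
  have h (i : Fin 2) : Measurable fun μ => y μ i :=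
    (EuclideanSpace.proj (𝕜 := ℂ) i).continuous.measurable.comp hy
  exact Measurable.ite measurableSet_Ioi (h 0) ((h 1).comp measurable_neg)

lemma lintegral_unfold_sq (y : ModelSpace) :
    ∫⁻ μ, ‖unfold y μ‖ₑ ^ 2 = ∫⁻ μ, ‖y μ‖ₑ ^ 2 ∂halfMeasure := by
  rw [← lintegral_halfMeasure_add_neg ((measurable_unfold y).enorm.pow_const 2)]
  refine lintegral_congr_ae ?_
  filter_upwards [ae_halfMeasure_pos] with μ hμ
  rw [unfold_pos _ hμ, unfold_neg _ hμ, enorm_sq_euclidean]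

lemma memLp_unfold (y : ModelSpace) : MemLp (unfold y) 2 := by
  refine ⟨(measurable_unfold y).aestronglyMeasurable,
    (ENNReal.pow_lt_top_iff.1 ?_).resolve_right two_ne_zero⟩
  rw [eLpNorm_two_sq, lintegral_unfold_sq, ← one_mul (∫⁻ _, _ ∂_), ← modelFactor_mul,
    mul_right_comm, ← lintegral_modelMeasure, ← eLpNorm_two_sq]
  exact ENNReal.mul_lt_top (ENNReal.pow_lt_top (Lp.memLp y).2) ENNReal.ofReal_lt_top

lemma integrable_apply_of_compactlySupported {y : ModelSpace}
    (hy : y ∈ compactlySupported (EuclideanSpace ℂ (Fin 2)) modelMeasure) (i : Fin 2) :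
    Integrable (fun μ => y μ i) modelMeasure := by
  simpa using integrable_mul_of_compactlySupported hy (k := fun _ => 1)
    (fun _ _ _ => continuousOn_const) (EuclideanSpace.proj i)

lemma integrable_unfold {y : ModelSpace}
    (hy : y ∈ compactlySupported (EuclideanSpace ℂ (Fin 2)) modelMeasure) :
    Integrable (unfold y) := by
  have h i := (integrable_modelMeasure_iff _).1 (integrable_apply_of_compactlySupported hy i)
  refine ⟨(measurable_unfold y).aestronglyMeasurable, ?_⟩
  rw [HasFiniteIntegral, ← lintegral_halfMeasure_add_neg (measurable_unfold y).enorm]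
  refine lt_of_eq_of_lt (lintegral_congr_ae ?_) ((h 0).norm.add (h 1).norm).2
  filter_upwards [ae_halfMeasure_pos] with μ hμ
  rw [unfold_pos _ hμ, unfold_neg _ hμ, Pi.add_apply, ← ofReal_norm, ← ofReal_norm, ← ofReal_norm,
    Real.norm_of_nonneg (by positivity), ENNReal.ofReal_add (by positivity) (by positivity)]

lemma check_exp {y : ModelSpace}
    (hy : y ∈ compactlySupported (EuclideanSpace ℂ (Fin 2)) modelMeasure) (u : ℝ) :
    check y (Real.exp u) =
      Complex.exp (-u / 2) * (1 / (2 * Real.pi) * phaseIntegral (unfold y) u) := by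
  have h : Integrable fun μ : ℝ => Complex.exp (Complex.I * u * μ) * unfold y μ :=
    (integrable_unfold hy).bdd_mul (c := 1) (by fun_prop)
      (ae_of_all _ fun μ => by simp [Complex.norm_exp])
  rw [check, integral_modelMeasure, phaseIntegral, ← integral_halfMeasure_add_neg h,
    mul_left_comm, ← integral_const_mul (Complex.exp _)]
  congr 1
  refine integral_congr_ae ?_
  filter_upwards [ae_halfMeasure_pos] with μ hμ
  rw [unfold_pos _ hμ, unfold_neg _ hμ, Fin.sum_univ_two, psi_exp, psi_exp]
  simp [psiSign]
  ring

lemma continuousOn_check {y : ModelSpace}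
    (hy : y ∈ compactlySupported (EuclideanSpace ℂ (Fin 2)) modelMeasure) :
    ContinuousOn (check y) (Ioi 0) := by
  have hc := continuous_phaseIntegral (integrable_unfold hy)
  have h : Continuous fun u : ℝ =>
      Complex.exp (-u / 2) * (1 / (2 * Real.pi) * phaseIntegral (unfold y) u) := by fun_prop
  refine (h.comp_continuousOn (Real.continuousOn_log.mono fun t (ht : 0 < t) => ht.ne')).congr
    fun t ht => ?_
  rw [Function.comp_apply, ← check_exp hy, Real.exp_log ht]

lemma enorm_one_div_two_pi : ‖(1 / (2 * Real.pi) : ℂ)‖ₑ = ENNReal.ofReal (1 / (2 * Real.pi)) := by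
  rw [← ofReal_norm]
  simp [abs_of_pos Real.pi_pos]

/-- Plancherel's theorem for `unfold y`: the Jacobian `e^u` cancels `|e^{-u/2}|²`, and `(1/(2π))² ·
2π` is the weight `1/(2π)` of the model measure. -/
lemma eLpNorm_check {y : ModelSpace}
    (hy : y ∈ compactlySupported (EuclideanSpace ℂ (Fin 2)) modelMeasure) :
    eLpNorm (check y) 2 halfMeasure = eLpNorm y 2 modelMeasure := by
  refine (ENNReal.pow_right_strictMono two_ne_zero).injective ?_
  rw [eLpNorm_two_sq, eLpNorm_two_sq, lintegral_modelMeasure,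
    lintegral_halfMeasure_eq]
  simp_rw [check_exp hy, ofReal_exp_mul_enorm_sq, enorm_mul, mul_pow]
  rw [lintegral_const_mul' _ _ (ENNReal.pow_ne_top enorm_ne_top),
    lintegral_phaseIntegral (integrable_unfold hy) (memLp_unfold y), enorm_one_div_two_pi, sq,
    mul_assoc, ← mul_assoc _ (ENNReal.ofReal (2 * Real.pi)), modelFactor_mul, one_mul,
    lintegral_unfold_sq]

/-! ### Unitarity -/

lemma dense_compactlySupported_half :
    Dense (compactlySupported ℂ halfMeasure : Set L2Half) :=
  dense_compactlySupported ae_halfMeasure_pos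

lemma dense_compactlySupported_model :
    Dense (compactlySupported (EuclideanSpace ℂ (Fin 2)) modelMeasure : Set ModelSpace) :=
  dense_compactlySupported ae_modelMeasure_pos

lemma U_ae_eq {x : L2Half} (hx : x ∈ compactlySupported ℂ halfMeasure) :
    U x =ᵐ[modelMeasure] hat x := by
  have hm (y : compactlySupported ℂ halfMeasure) :
      AEStronglyMeasurable (hatLin y) modelMeasure := (continuous_hat y.2).aestronglyMeasurable
  have hn (y : compactlySupported ℂ halfMeasure) :
      eLpNorm (hatLin y) 2 modelMeasure ≤ eLpNorm (y : L2Half) 2 halfMeasure :=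
    (eLpNorm_hat y.2).le
  exact l2Extension_ae_eq dense_compactlySupported_half hm hn ⟨x, hx⟩

lemma Uinv_ae_eq {y : ModelSpace}
    (hy : y ∈ compactlySupported (EuclideanSpace ℂ (Fin 2)) modelMeasure) :
    Uinv y =ᵐ[halfMeasure] check y := by
  have hm (y : compactlySupported (EuclideanSpace ℂ (Fin 2)) modelMeasure) :
      AEStronglyMeasurable (checkLin y) halfMeasure :=
    (continuousOn_check y.2).aestronglyMeasurable measurableSet_Ioi
  have hn (y : compactlySupported (EuclideanSpace ℂ (Fin 2)) modelMeasure) :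
      eLpNorm (checkLin y) 2 halfMeasure ≤ eLpNorm (y : ModelSpace) 2 modelMeasure :=
    (eLpNorm_check y.2).le
  exact l2Extension_ae_eq dense_compactlySupported_model hm hn ⟨y, hy⟩

lemma norm_U (x : L2Half) : ‖U x‖ = ‖x‖ := by
  refine dense_compactlySupported_half.induction (P := fun x => ‖U x‖ = ‖x‖) (fun x hx => ?_)
    (isClosed_eq (by fun_prop) (by fun_prop)) x
  rw [Lp.norm_def, Lp.norm_def, eLpNorm_congr_ae (U_ae_eq hx), eLpNorm_hat hx]

lemma norm_Uinv (y : ModelSpace) : ‖Uinv y‖ = ‖y‖ := by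
  refine dense_compactlySupported_model.induction (P := fun y => ‖Uinv y‖ = ‖y‖) (fun y hy => ?_)
    (isClosed_eq (by fun_prop) (by fun_prop)) y
  rw [Lp.norm_def, Lp.norm_def, eLpNorm_congr_ae (Uinv_ae_eq hy), eLpNorm_check hy]

lemma integrable_psi_mul_prod {x : L2Half} (hx : x ∈ compactlySupported ℂ halfMeasure)
    {y : ModelSpace} (hy : y ∈ compactlySupported (EuclideanSpace ℂ (Fin 2)) modelMeasure)
    (i : Fin 2) :
    Integrable (fun p : ℝ × ℝ => psi p.1 p.2 i * y p.2 i * (starRingEnd ℂ) (x p.1))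
      (halfMeasure.prod modelMeasure) := by
  have h1 := Complex.conjLIE.integrable_comp_iff.2 <| integrable_mul_of_compactlySupported hx
    (k := fun t : ℝ => ((t ^ (-1 / 2 : ℝ) : ℝ) : ℂ))
    (fun _ _ ha => continuousOn_rpow_ofReal _ ha) (ContinuousLinearMap.id ℂ ℂ)
  have hy' : StronglyMeasurable fun μ => y μ i :=
    (EuclideanSpace.proj (𝕜 := ℂ) i).continuous.comp_stronglyMeasurable (Lp.stronglyMeasurable y)
  have hx' : StronglyMeasurable fun t => (starRingEnd ℂ) (x t) :=
    Complex.continuous_conj.comp_stronglyMeasurable (Lp.stronglyMeasurable x)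
  refine (h1.mul_prod (integrable_apply_of_compactlySupported hy i)).mono
    (((measurable_psi i).stronglyMeasurable.mul (hy'.comp_measurable measurable_snd)).mul
      (hx'.comp_measurable measurable_fst)).aestronglyMeasurable ?_
  filter_upwards [Measure.quasiMeasurePreserving_fst.ae ae_halfMeasure_pos] with p hp
  have : |p.1 ^ (-1 / 2 : ℝ)| = p.1 ^ (-1 / 2 : ℝ) := abs_of_nonneg (by positivity)
  simp only [norm_mul, norm_psi hp, RCLike.norm_conj, Complex.conjLIE_apply,
    ContinuousLinearMap.id_apply, Complex.norm_real, Real.norm_eq_abs, this]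
  exact le_of_eq (by ring)

/-- Both integrals have the kernel `ψ`, conjugated in one of them, so for compactly supported `x`
and `y` this is Fubini's theorem. Density and continuity in each variable do the rest. -/
lemma inner_U_left (x : L2Half) (y : ModelSpace) : inner ℂ (U x) y = inner ℂ x (Uinv y) := by
  refine dense_compactlySupported_half.induction
    (P := fun x => inner ℂ (U x) y = inner ℂ x (Uinv y)) (fun x hx => ?_)
    (isClosed_eq (by fun_prop) (by fun_prop)) x
  refine dense_compactlySupported_model.induction
    (P := fun y => inner ℂ (U x) y = inner ℂ x (Uinv y)) (fun y hy => ?_)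
    (isClosed_eq (by fun_prop) (by fun_prop)) y
  have h1 : inner ℂ (U x) y = ∫ μ, ∫ t, ∑ i, psi t μ i * y μ i * (starRingEnd ℂ) (x t)
      ∂halfMeasure ∂modelMeasure := by
    rw [L2.inner_def]
    refine integral_congr_ae ?_
    filter_upwards [U_ae_eq hx] with μ hμ
    have hi (i : Fin 2) :
        Integrable (fun t => psi t μ i * y μ i * (starRingEnd ℂ) (x t)) halfMeasure := by
      refine ((Complex.conjLIE.integrable_comp_iff.2 (integrable_hat hx μ i)).const_mul
        (y μ i)).congr (ae_of_all _ fun t => ?_)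
      simp
      ring
    rw [hμ, PiLp.inner_apply, integral_finsetSum _ fun i _ => hi i]
    refine Finset.sum_congr rfl fun i _ => ?_
    rw [RCLike.inner_apply, hat, PiLp.toLp_apply, ← integral_conj, ← integral_const_mul]
    refine integral_congr_ae (ae_of_all _ fun t => ?_)
    simp
    ring
  have h2 : inner ℂ x (Uinv y) = ∫ t, ∫ μ, ∑ i, psi t μ i * y μ i * (starRingEnd ℂ) (x t)
      ∂modelMeasure ∂halfMeasure := by
    rw [L2.inner_def]
    refine integral_congr_ae ?_
    filter_upwards [Uinv_ae_eq hy] with t ht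
    rw [ht, RCLike.inner_apply, check, ← integral_mul_const]
    simp_rw [Finset.sum_mul]
  rw [h1, h2, integral_integral_swap]
  refine Integrable.swap (f := fun p : ℝ × ℝ =>
    ∑ i, psi p.1 p.2 i * y p.2 i * (starRingEnd ℂ) (x p.1)) ?_
  exact integrable_finsetSum _ fun i _ => integrable_psi_mul_prod hx hy i

lemma adjoint_Uinv : Uinv.adjoint = U :=
  ((ContinuousLinearMap.eq_adjoint_iff _ _).2 inner_U_left).symm

lemma adjoint_U : U.adjoint = Uinv := by
  rw [← adjoint_Uinv, ContinuousLinearMap.adjoint_adjoint]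

/-- An isometry `A` satisfies `A* A = 1`. Applied to `U` here and to `Uinv` below, this gives both
inverse relations. -/
lemma Uinv_U (x : L2Half) : Uinv (U x) = x := by
  have h := (ContinuousLinearMap.norm_map_iff_adjoint_comp_self U).1 norm_U
  rw [adjoint_U] at h
  exact DFunLike.congr_fun h x

lemma U_Uinv (y : ModelSpace) : U (Uinv y) = y := by
  have h := (ContinuousLinearMap.norm_map_iff_adjoint_comp_self Uinv).1 norm_Uinv
  rw [adjoint_Uinv] at h
  exact DFunLike.congr_fun h y

/-! ### The entries of `F` -/

/-- The exponents `1/2 ± iμ`. -/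
noncomputable def psiExponent (i : Fin 2) (μ : ℝ) : ℂ := 1 / 2 + Complex.I * (psiSign i * μ : ℝ)

lemma psiExponent_re (i : Fin 2) (μ : ℝ) : (psiExponent i μ).re = 1 / 2 := by
  simp [psiExponent]

lemma psiExponent_im (i : Fin 2) (μ : ℝ) : (psiExponent i μ).im = psiSign i * μ := by
  simp [psiExponent]

lemma psi_eq_cpow_psiExponent (t μ : ℝ) (i : Fin 2) :
    psi t μ i = (t : ℂ) ^ (psiExponent i μ - 1) := by
  rw [psi_eq_cpow, psiExponent]
  congr 1
  ring

lemma continuous_psiExponent (i : Fin 2) : Continuous (psiExponent i) := by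
  unfold psiExponent
  fun_prop

lemma continuous_Gamma_psiExponent (i : Fin 2) :
    Continuous fun μ => Complex.Gamma (psiExponent i μ) := by
  refine continuous_iff_continuousAt.2 fun μ => ?_
  refine ContinuousAt.comp (Complex.differentiableAt_Gamma _ fun m h => ?_).continuousAt
    (continuous_psiExponent i).continuousAt
  have h1 := congrArg Complex.re h
  rw [psiExponent_re, Complex.neg_re, Complex.natCast_re] at h1
  have : (0 : ℝ) ≤ m := m.cast_nonneg
  linarith

/-- The entry of `F` in the column `i` outside of the diagonal. -/
noncomputable def fEntry (i : Fin 2) (μ : ℝ) : ℂ :=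
  1 / (Real.sqrt (2 * Real.pi) : ℂ) *
    Complex.exp (Complex.I * Real.pi / 2 * psiExponent i μ) * Complex.Gamma (psiExponent i μ)

lemma fMinusPlus_eq (μ : ℝ) : fMinusPlus μ = fEntry 0 μ := by
  rw [fMinusPlus, fEntry, psiExponent]
  simp only [psiSign, Matrix.cons_val_zero, one_mul]
  congr 3
  linear_combination (-(μ * Real.pi / 2 : ℂ)) * Complex.I_sq

lemma fPlusMinus_eq (μ : ℝ) : fPlusMinus μ = fEntry 1 μ := by
  rw [fPlusMinus, fEntry, psiExponent]
  simp only [psiSign, Matrix.cons_val_one, neg_one_mul, Matrix.cons_val_fin_one]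
  push_cast
  congr 3
  · linear_combination (μ * Real.pi / 2 : ℂ) * Complex.I_sq
  · ring

lemma continuous_fEntry (i : Fin 2) : Continuous (fEntry i) := by
  have h1 := continuous_psiExponent i
  have h2 := continuous_Gamma_psiExponent i
  unfold fEntry
  fun_prop

/-- On the line `Re z = 1/2` one has `1 - z = conj z`, so the reflection formula `Γ(z) Γ(1 - z) = π
/ sin πz` computes `|Γ(z)|²`. -/
lemma norm_Gamma_half_add_sq (s : ℝ) :
    ‖Complex.Gamma (1 / 2 + Complex.I * s)‖ ^ 2 = Real.pi / Real.cosh (Real.pi * s) := by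
  have h : (conj (Complex.Gamma (1 / 2 + Complex.I * s))) =
      Complex.Gamma (1 - (1 / 2 + Complex.I * s)) := by
    rw [← Complex.Gamma_conj]
    congr 1
    simp [map_ofNat]
    ring
  have h2 := Complex.Gamma_mul_Gamma_one_sub (1 / 2 + Complex.I * s)
  have h3 : Complex.sin (Real.pi * (1 / 2 + Complex.I * s)) = Real.cosh (Real.pi * s) := by
    have : (Real.pi : ℂ) * (1 / 2 + Complex.I * s) =
        ((Real.pi * s : ℝ) : ℂ) * Complex.I + Real.pi / 2 := by
      push_cast
      ring
    rw [this, Complex.sin_add_pi_div_two, Complex.cos_mul_I, Complex.ofReal_cosh]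
  rw [← h, Complex.mul_conj', h3] at h2
  exact_mod_cast h2

/-- With `s = ±μ` the squared modulus equals `e^{-πs} / (e^{πs} + e^{-πs})`. -/
lemma norm_fEntry_le_one (i : Fin 2) (μ : ℝ) : ‖fEntry i μ‖ ≤ 1 := by
  refine (sq_le_one_iff₀ (norm_nonneg _)).1 ?_
  set s := psiSign i * μ with hs
  have h1 : (Complex.I * Real.pi / 2 * psiExponent i μ).re = -(Real.pi * s / 2) := by
    have : Complex.I * Real.pi / 2 * psiExponent i μ =
        ((Real.pi / 2 : ℝ) : ℂ) * (Complex.I * psiExponent i μ) := by push_cast; ring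
    rw [this, Complex.re_ofReal_mul, Complex.I_mul_re, psiExponent_im, ← hs]
    ring
  have hp := Real.pi_pos
  rw [fEntry, norm_mul, norm_mul, mul_pow, mul_pow, norm_div, norm_one, Complex.norm_real,
    Real.norm_of_nonneg (Real.sqrt_nonneg _), div_pow, Real.sq_sqrt Real.two_pi_pos.le,
    Complex.norm_exp, h1, psiExponent, norm_Gamma_half_add_sq, ← Real.exp_nat_mul, Real.cosh_eq,
    show ((2 : ℕ) : ℝ) * -(Real.pi * s / 2) = -(Real.pi * s) by push_cast; ring]
  have e1 := Real.exp_pos (Real.pi * s)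
  have e2 := Real.exp_pos (-(Real.pi * s))
  have : 1 ^ 2 / (2 * Real.pi) * Real.exp (-(Real.pi * s)) *
      (Real.pi / ((Real.exp (Real.pi * s) + Real.exp (-(Real.pi * s))) / 2)) =
      Real.exp (-(Real.pi * s)) / (Real.exp (Real.pi * s) + Real.exp (-(Real.pi * s))) := by
    field_simp
  rw [this, div_le_one (by positivity)]
  linarith

/-! ### Multiplication by contractive matrix functions -/

section Multiplication

variable {G : ℝ → Matrix (Fin 2) (Fin 2) ℂ}

lemma memLp_mul_of_contractive (hm : Continuous G)
    (hn : ∀ μ v, ‖(G μ).toEuclideanLin v‖ ≤ ‖v‖) (y : ModelSpace) :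
    MemLp (fun μ => (G μ).toEuclideanLin (y μ)) 2 modelMeasure := by
  refine (Lp.memLp y).of_le ?_ (ae_of_all _ fun μ => hn μ _)
  have hy (j : Fin 2) : Measurable fun μ => y μ j :=
    (EuclideanSpace.proj (𝕜 := ℂ) j).continuous.measurable.comp (Lp.stronglyMeasurable y).measurable
  have hG (i j : Fin 2) : Measurable fun μ => G μ i j := (hm.matrix_elem i j).measurable
  have h : Measurable fun μ => WithLp.toLp 2 fun i => ∑ j, G μ i j * y μ j := by fun_prop
  exact h.aestronglyMeasurable

lemma mulOp_domain_eq_top (hm : Continuous G)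
    (hn : ∀ μ v, ‖(G μ).toEuclideanLin v‖ ≤ ‖v‖) : (mulOp G).domain = ⊤ :=
  eq_top_iff.2 fun y _ => memLp_mul_of_contractive hm hn y

lemma mulOp_ae_eq (y : (mulOp G).domain) :
    mulOp G y =ᵐ[modelMeasure] fun μ => (G μ).toEuclideanLin ((y : ModelSpace) μ) :=
  MemLp.coeFn_toLp (mem_mulDomain.1 y.2)

/-- Multiplication by a contractive matrix function as a bounded operator. -/
noncomputable def contractiveMul (hm : Continuous G) (hn : ∀ μ v, ‖(G μ).toEuclideanLin v‖ ≤ ‖v‖) :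
    ModelSpace →L[ℂ] ModelSpace :=
  LinearMap.mkContinuous
    { toFun := fun y => mulOp G ⟨y, memLp_mul_of_contractive hm hn y⟩
      map_add' := fun x y => (mulOp G).map_add ⟨x, memLp_mul_of_contractive hm hn x⟩
        ⟨y, memLp_mul_of_contractive hm hn y⟩
      map_smul' := fun c y => (mulOp G).map_smul c ⟨y, memLp_mul_of_contractive hm hn y⟩ } 1
    fun y => by
      rw [one_mul]
      refine Lp.norm_le_norm_of_ae_le ?_
      filter_upwards [mulOp_ae_eq ⟨y, memLp_mul_of_contractive hm hn y⟩] with μ h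
      exact (congrArg norm h).trans_le (hn μ _)

lemma contractiveMul_ae_eq (hm : Continuous G) (hn : ∀ μ v, ‖(G μ).toEuclideanLin v‖ ≤ ‖v‖)
    (y : ModelSpace) :
    contractiveMul hm hn y =ᵐ[modelMeasure] fun μ => (G μ).toEuclideanLin (y μ) :=
  mulOp_ae_eq ⟨y, memLp_mul_of_contractive hm hn y⟩

lemma adjoint_contractiveMul (hm : Continuous G)
    (hn : ∀ μ v, ‖(G μ).toEuclideanLin v‖ ≤ ‖v‖)
    (hm' : Continuous fun μ => (G μ).conjTranspose)
    (hn' : ∀ μ v, ‖(G μ).conjTranspose.toEuclideanLin v‖ ≤ ‖v‖) :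
    (contractiveMul hm hn).adjoint = contractiveMul hm' hn' := by
  refine ((ContinuousLinearMap.eq_adjoint_iff _ _).2 fun y z => ?_).symm
  rw [L2.inner_def, L2.inner_def]
  refine integral_congr_ae ?_
  filter_upwards [contractiveMul_ae_eq hm hn z, contractiveMul_ae_eq hm' hn' y] with μ h1 h2
  rw [h1, h2, Matrix.toEuclideanLin_conjTranspose_eq_adjoint, LinearMap.adjoint_inner_left]

end Multiplication

lemma norm_antidiagonal_le {a b : ℂ} (ha : ‖a‖ ≤ 1) (hb : ‖b‖ ≤ 1)
    (v : EuclideanSpace ℂ (Fin 2)) : ‖(!![0, a; b, 0]).toEuclideanLin v‖ ≤ ‖v‖ := by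
  rw [EuclideanSpace.norm_eq, EuclideanSpace.norm_eq]
  refine Real.sqrt_le_sqrt ?_
  have h (c z : ℂ) (hc : ‖c‖ ≤ 1) : ‖c * z‖ ^ 2 ≤ ‖z‖ ^ 2 := by
    rw [norm_mul]
    gcongr
    exact mul_le_of_le_one_left (norm_nonneg _) hc
  simpa [Fin.sum_univ_two, Matrix.toLpLin_apply, Matrix.mulVec, dotProduct, add_comm]
    using add_le_add (h a (v 1) ha) (h b (v 0) hb)

lemma Fmat_eq (μ : ℝ) : Fmat μ = !![0, fEntry 1 μ; fEntry 0 μ, 0] := by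
  rw [Fmat, fPlusMinus_eq, fMinusPlus_eq]

lemma continuous_Fmat : Continuous Fmat := by
  refine continuous_matrix fun i j => ?_
  simp_rw [Fmat_eq]
  fin_cases i <;> fin_cases j
  · exact continuous_const
  · exact continuous_fEntry 1
  · exact continuous_fEntry 0
  · exact continuous_const

lemma norm_Fmat_le (μ : ℝ) (v : EuclideanSpace ℂ (Fin 2)) :
    ‖(Fmat μ).toEuclideanLin v‖ ≤ ‖v‖ := by
  rw [Fmat_eq]
  exact norm_antidiagonal_le (norm_fEntry_le_one 1 μ) (norm_fEntry_le_one 0 μ) v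

lemma norm_Fmat_conjTranspose_le (μ : ℝ) (v : EuclideanSpace ℂ (Fin 2)) :
    ‖(Fmat μ).conjTranspose.toEuclideanLin v‖ ≤ ‖v‖ := by
  have h : (Fmat μ).conjTranspose = !![0, star (fEntry 0 μ); star (fEntry 1 μ), 0] := by
    rw [Fmat_eq]
    ext i j
    fin_cases i <;> fin_cases j <;> simp
  rw [h]
  exact norm_antidiagonal_le ((norm_star _).trans_le (norm_fEntry_le_one 0 μ))
    ((norm_star _).trans_le (norm_fEntry_le_one 1 μ)) v

/-! ### The truncated Fourier operator in the model space -/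

lemma integrable_exp_neg_mul_psi_prod {y : ModelSpace}
    (hy : y ∈ compactlySupported (EuclideanSpace ℂ (Fin 2)) modelMeasure)
    {r : ℂ} (hr : 0 < r.re) (i : Fin 2) :
    Integrable (fun p : ℝ × ℝ => Complex.exp (-(r * p.1)) * (psi p.1 p.2 i * y p.2 i))
      (halfMeasure.prod modelMeasure) := by
  have h1 := integrableOn_cpow_mul_exp_neg_mul (a := 1 / 2) (by norm_num) hr
  have hy' : StronglyMeasurable fun μ => y μ i :=
    (EuclideanSpace.proj (𝕜 := ℂ) i).continuous.comp_stronglyMeasurable (Lp.stronglyMeasurable y)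
  refine (Integrable.mul_prod h1 (integrable_apply_of_compactlySupported hy i)).mono
    (StronglyMeasurable.mul (by fun_prop : Continuous fun p : ℝ × ℝ =>
      Complex.exp (-(r * p.1))).stronglyMeasurable ((measurable_psi i).stronglyMeasurable.mul
      (hy'.comp_measurable measurable_snd))).aestronglyMeasurable ?_
  filter_upwards [Measure.quasiMeasurePreserving_fst.ae ae_halfMeasure_pos] with p hp
  simp only [norm_mul, norm_psi hp, Complex.norm_cpow_eq_rpow_re_of_pos hp]
  norm_num
  exact le_of_eq (by ring)

lemma integrable_exp_neg_mul_check {y : ModelSpace}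
    (hy : y ∈ compactlySupported (EuclideanSpace ℂ (Fin 2)) modelMeasure)
    {r : ℂ} (hr : 0 < r.re) :
    Integrable (fun t : ℝ => Complex.exp (-(r * t)) * check y t) halfMeasure := by
  refine (integrable_finsetSum Finset.univ fun i _ =>
    integrable_exp_neg_mul_psi_prod hy hr i).integral_prod_left.congr (ae_of_all _ fun t => ?_)
  simp only [check, ← integral_const_mul, Finset.mul_sum]

/-- The damping `Re r > 0` makes the double integral absolutely convergent, so the Laplace transform
may be taken of each power `t^{a-1}` under the integral over `μ`. -/
lemma integral_exp_neg_mul_check {y : ModelSpace}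
    (hy : y ∈ compactlySupported (EuclideanSpace ℂ (Fin 2)) modelMeasure)
    {r : ℂ} (hr : 0 < r.re) :
    ∫ t : ℝ, Complex.exp (-(r * t)) * check y t ∂halfMeasure =
      ∫ μ, ∑ i, (1 / r) ^ psiExponent i μ * (Complex.Gamma (psiExponent i μ) * y μ i)
        ∂modelMeasure := by
  simp only [check, ← integral_const_mul, Finset.mul_sum]
  rw [integral_integral_swap (integrable_finsetSum Finset.univ fun i _ =>
    integrable_exp_neg_mul_psi_prod hy hr i)]
  refine integral_congr_ae (ae_of_all _ fun μ => ?_)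
  have h (i : Fin 2) : (fun t : ℝ => Complex.exp (-(r * t)) * (psi t μ i * y μ i)) =
      fun t : ℝ => (t : ℂ) ^ (psiExponent i μ - 1) * Complex.exp (-(r * t)) * y μ i := by
    funext t
    rw [psi_eq_cpow_psiExponent]
    ring
  have ha (i : Fin 2) : 0 < (psiExponent i μ).re := by
    rw [psiExponent_re]
    norm_num
  dsimp only
  rw [integral_finsetSum]
  · refine Finset.sum_congr rfl fun i _ => ?_
    rw [h, integral_mul_const, integral_cpow_mul_exp_neg_complex_mul_Ioi (ha i) hr, mul_assoc]
  · intro i _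
    rw [h]
    exact (integrableOn_cpow_mul_exp_neg_mul (ha i) hr).mul_const _

/-- A majorant uniform in `r`. Its growth in `μ`, from `|arg| ≤ π`, is harmless because it is used
on compactly supported `y`. -/
lemma norm_cpow_psiExponent_le {t : ℝ} (ht : 0 < t) {r : ℂ} (hr : t ≤ ‖r‖) (i : Fin 2) (μ : ℝ) :
    ‖(1 / r) ^ psiExponent i μ‖ ≤ t⁻¹ ^ (1 / 2 : ℝ) * Real.exp (Real.pi * |μ|) := by
  refine (Complex.norm_cpow_le _ _).trans ?_
  rw [psiExponent_re, psiExponent_im, div_eq_mul_inv _ (Real.exp _), ← Real.exp_neg, norm_div,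
    norm_one, one_div ‖r‖]
  gcongr
  have h1 : |psiSign i * μ| = |μ| := by fin_cases i <;> simp [psiSign]
  rw [← h1]
  calc _ ≤ |Complex.arg (1 / r) * (psiSign i * μ)| := neg_le_abs _
    _ ≤ _ := by
      rw [abs_mul]
      gcongr
      exact Complex.abs_arg_le_pi _

/-- The boundary value `r = -it` has `1/r = i/t`, and `(i/t)^a = e^{iπa/2} t^{-a}`. Passing from `a
- 1` to `-a` flips the sign of `iμ`, hence the swapped index `1 - i`. -/
lemma cpow_psiExponent_eq {t : ℝ} (ht : 0 < t) (i : Fin 2) (μ : ℝ) :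
    1 / (Real.sqrt (2 * Real.pi) : ℂ) *
      ((1 / (-(Complex.I * t))) ^ psiExponent i μ * Complex.Gamma (psiExponent i μ)) =
      fEntry i μ * psi t μ (1 - i) := by
  have h0 : (t : ℂ) ≠ 0 := by exact_mod_cast ht.ne'
  have e : 1 / (-(Complex.I * t)) = ((t⁻¹ : ℝ) : ℂ) * Complex.I := by
    push_cast
    field_simp
    linear_combination -Complex.I_sq
  have hI : Complex.I ^ psiExponent i μ =
      Complex.exp (Complex.I * Real.pi / 2 * psiExponent i μ) := by
    rw [Complex.cpow_def_of_ne_zero Complex.I_ne_zero, Complex.log_I]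
    congr 1
    ring
  have hp : ((t⁻¹ : ℝ) : ℂ) ^ psiExponent i μ = psi t μ (1 - i) := by
    rw [Complex.ofReal_inv, Complex.inv_cpow _ _
      (by rw [Complex.arg_ofReal_of_nonneg ht.le]; exact Real.pi_ne_zero.symm), ← Complex.cpow_neg,
      psi_eq_cpow, psiExponent]
    congr 1
    fin_cases i <;> simp [psiSign] <;> ring
  have hm : (((t⁻¹ : ℝ) : ℂ) * Complex.I) ^ psiExponent i μ =
      ((t⁻¹ : ℝ) : ℂ) ^ psiExponent i μ * Complex.I ^ psiExponent i μ := by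
    have h1 : ((t⁻¹ : ℝ) : ℂ) ≠ 0 := by exact_mod_cast (inv_pos.2 ht).ne'
    rw [Complex.cpow_def_of_ne_zero (mul_ne_zero h1 Complex.I_ne_zero),
      Complex.cpow_def_of_ne_zero h1, Complex.cpow_def_of_ne_zero Complex.I_ne_zero,
      Complex.log_ofReal_mul (inv_pos.2 ht) Complex.I_ne_zero, ← Complex.exp_add, add_mul,
      Complex.ofReal_log (inv_pos.2 ht).le]
  rw [e, hm, hp, hI, fEntry]
  ring

lemma sum_fEntry_mul_psi (t μ : ℝ) (v : EuclideanSpace ℂ (Fin 2)) :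
    ∑ i, fEntry i μ * psi t μ (1 - i) * v i =
      ∑ i, psi t μ i * (Fmat μ).toEuclideanLin v i := by
  rw [Fmat_eq]
  simp [Fin.sum_univ_two, Matrix.toLpLin_apply, dotProduct]
  ring

/-- The Fourier integrals of the regularized functions `e^{-εt} y̌(t)` converge pointwise. -/
lemma tendsto_fourierIntegral_regularized {y : ModelSpace}
    (hy : y ∈ compactlySupported (EuclideanSpace ℂ (Fin 2)) modelMeasure)
    {ε : ℕ → ℝ} (hε : ∀ n, 0 < ε n)
    (hε0 : Tendsto ε atTop (𝓝 0)) {t : ℝ} (ht : 0 < t) :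
    Tendsto (fun n => fourierIntegral (fun ξ => Complex.exp (-(ε n * ξ)) * check y ξ) t) atTop
      (𝓝 (∫ μ, ∑ i, psi t μ i * (Fmat μ).toEuclideanLin (y μ) i ∂modelMeasure)) := by
  have hr n : 0 < ((ε n : ℂ) - Complex.I * t).re := by simpa using hε n
  have e1 n : fourierIntegral (fun ξ => Complex.exp (-(ε n * ξ)) * check y ξ) t =
      1 / (Real.sqrt (2 * Real.pi) : ℂ) * ∫ μ, ∑ i, (1 / ((ε n : ℂ) - Complex.I * t)) ^
        psiExponent i μ * (Complex.Gamma (psiExponent i μ) * y μ i) ∂modelMeasure := by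
    rw [← integral_exp_neg_mul_check hy (hr n), fourierIntegral]
    congr 1
    refine integral_congr_ae (ae_of_all _ fun ξ => ?_)
    dsimp only
    rw [← mul_assoc, ← Complex.exp_add]
    congr 2
    ring
  have e2 : ∫ μ, ∑ i, psi t μ i * (Fmat μ).toEuclideanLin (y μ) i ∂modelMeasure =
      1 / (Real.sqrt (2 * Real.pi) : ℂ) * ∫ μ, ∑ i, (1 / (-(Complex.I * t))) ^
        psiExponent i μ * (Complex.Gamma (psiExponent i μ) * y μ i) ∂modelMeasure := by
    rw [← integral_const_mul]
    refine integral_congr_ae (ae_of_all _ fun μ => ?_)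
    dsimp only
    rw [← sum_fEntry_mul_psi, Finset.mul_sum]
    refine Finset.sum_congr rfl fun i _ => ?_
    rw [← cpow_psiExponent_eq ht]
    ring
  simp_rw [e1, e2]
  refine Tendsto.const_mul _ ?_
  have hi (i : Fin 2) : Integrable (fun μ => (((t⁻¹ ^ (1 / 2 : ℝ) * Real.exp (Real.pi * |μ|) : ℝ)) *
      Complex.Gamma (psiExponent i μ)) * y μ i) modelMeasure := by
    refine integrable_mul_of_compactlySupported hy (k := fun μ =>
      ((t⁻¹ ^ (1 / 2 : ℝ) * Real.exp (Real.pi * |μ|) : ℝ)) * Complex.Gamma (psiExponent i μ))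
      (fun _ _ _ => Continuous.continuousOn ?_) (EuclideanSpace.proj i)
    have := continuous_Gamma_psiExponent i
    fun_prop
  have hlim : Tendsto (fun n => 1 / ((ε n : ℂ) - Complex.I * t)) atTop
      (𝓝 (1 / (-(Complex.I * t)))) := by
    have h1 : Tendsto (fun n => (ε n : ℂ) - Complex.I * t) atTop (𝓝 (-(Complex.I * t))) := by
      have := (Complex.continuous_ofReal.tendsto 0).comp hε0
      simpa using this.sub_const (Complex.I * t)
    refine tendsto_const_nhds.div h1 (neg_ne_zero.2 (mul_ne_zero Complex.I_ne_zero ?_))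
    exact_mod_cast ht.ne'
  -- The limit `i/t` avoids the cut along the negative axis, so the power is continuous there.
  have hslit : 1 / (-(Complex.I * t)) ∈ Complex.slitPlane := by
    refine Or.inr ?_
    have e : 1 / (-(Complex.I * t)) = ((t⁻¹ : ℝ) : ℂ) * Complex.I := by
      have h0 : (t : ℂ) ≠ 0 := by exact_mod_cast ht.ne'
      push_cast
      field_simp
      linear_combination -Complex.I_sq
    rw [e]
    simpa using ht.ne'
  have hym (i : Fin 2) : AEStronglyMeasurable (fun μ => y μ i) modelMeasure :=
    (integrable_apply_of_compactlySupported hy i).1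
  refine tendsto_integral_of_dominated_convergence _ (fun n => ?_)
    (integrable_finsetSum Finset.univ fun i _ => (hi i).norm) (fun n => ae_of_all _ fun μ => ?_)
    (ae_of_all _ fun μ => ?_)
  · refine Finset.aestronglyMeasurable_fun_sum _ fun i _ => AEStronglyMeasurable.mul ?_
      ((continuous_Gamma_psiExponent i).aestronglyMeasurable.mul (hym i))
    refine Continuous.aestronglyMeasurable ?_
    refine Continuous.const_cpow (continuous_psiExponent i) (Or.inl ?_)
    refine one_div_ne_zero fun h => ?_
    have := hr n
    rw [h, Complex.zero_re] at this
    exact lt_irrefl _ this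
  · refine norm_sum_le_of_le _ fun i _ => ?_
    rw [← mul_assoc, norm_mul, norm_mul, norm_mul, norm_mul, Complex.norm_real]
    gcongr
    refine (norm_cpow_psiExponent_le ht ?_ i μ).trans (Real.le_norm_self _)
    -- `|ε - it| ≥ |Im(ε - it)| = t`, a lower bound independent of `ε`.
    refine le_trans ?_ (Complex.abs_im_le_norm _)
    simp [abs_of_pos ht]
  · refine tendsto_finsetSum _ fun i _ => Tendsto.mul_const _ ?_
    exact (continuousAt_cpow_const hslit).tendsto.comp hlim

/-- As `y̌` need not be integrable, the operator is applied to `e^{-εt} y̌`, which is. The images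
converge in `L²` by continuity of the operator and pointwise by the Laplace formula; the two limits
agree almost everywhere. -/
lemma truncatedFourier_Uinv_ae_eq {y : ModelSpace}
    (hy : y ∈ compactlySupported (EuclideanSpace ℂ (Fin 2)) modelMeasure) :
    truncatedFourier (Uinv y) =ᵐ[halfMeasure] fun t =>
      ∫ μ, ∑ i, psi t μ i * (Fmat μ).toEuclideanLin (y μ) i ∂modelMeasure := by
  let ε : ℕ → ℝ := fun n => 1 / ((n : ℝ) + 1)
  have hε n : 0 < ε n := Nat.one_div_pos_of_nat
  have hε0 : Tendsto ε atTop (𝓝 0) := tendsto_one_div_add_atTop_nhds_zero_nat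
  let w : ℕ → ℝ → ℂ := fun n ξ => Complex.exp (-(ε n * ξ)) * check y ξ
  have hwi n : Integrable (w n) halfMeasure :=
    integrable_exp_neg_mul_check hy (r := ε n) (by simpa using hε n)
  have hc : MemLp (check y) 2 halfMeasure := (Lp.memLp (Uinv y)).ae_eq (Uinv_ae_eq hy)
  have hb n : ∀ᵐ ξ ∂halfMeasure, ‖w n ξ‖ ≤ ‖check y ξ‖ := by
    filter_upwards [ae_halfMeasure_pos] with ξ hξ
    rw [norm_mul, Complex.norm_exp]
    refine mul_le_of_le_one_left (norm_nonneg _) (Real.exp_le_one_iff.2 ?_)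
    have := mul_pos (hε n) hξ
    simp only [Complex.neg_re, Complex.re_ofReal_mul, Complex.ofReal_re]
    linarith
  have hw n : MemLp (w n) 2 halfMeasure := hc.of_le (hwi n).1 (hb n)
  have hlim : Tendsto (fun n => (hw n).toLp (w n)) atTop (𝓝 (hc.toLp (check y))) := by
    refine tendsto_toLp_of_dominated hw hc hb (ae_of_all _ fun ξ => ?_)
    have h1 : Tendsto (fun n => Complex.exp (-(ε n * ξ))) atTop (𝓝 1) := by
      have h2 : Continuous fun e : ℝ => Complex.exp (-(e * ξ)) := by fun_prop
      simpa [Function.comp_def] using (h2.tendsto 0).comp hε0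
    simpa using h1.mul_const (check y ξ)
  have hU : hc.toLp (check y) = Uinv y :=
    Lp.ext (hc.coeFn_toLp.trans (Uinv_ae_eq hy).symm)
  rw [hU] at hlim
  -- Convergence in `L²` gives almost everywhere convergence along a subsequence, which is enough to
  -- identify the limit.
  obtain ⟨ns, hns, hae⟩ := (tendstoInMeasure_of_tendsto_Lp
    ((truncatedFourier.continuous.tendsto _).comp hlim)).exists_seq_tendsto_ae
  have hF n : truncatedFourier ((hw n).toLp (w n)) =ᵐ[halfMeasure] fourierIntegral (w n) := by
    have h1 := (hw n).coeFn_toLp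
    refine (truncatedFourier_ae_eq ((hwi n).congr h1.symm)).trans (ae_of_all _ fun t => ?_)
    rw [fourierIntegral, fourierIntegral]
    congr 1
    refine integral_congr_ae ?_
    filter_upwards [h1] with ξ h
    rw [h]
  filter_upwards [hae, ae_all_iff.2 hF, ae_halfMeasure_pos] with t h1 h2 ht
  refine tendsto_nhds_unique h1 ?_
  simp only [Function.comp_apply, h2]
  exact (tendsto_fourierIntegral_regularized hy hε hε0 ht).comp hns.tendsto_atTop

lemma truncatedFourier_comp_Uinv (y : ModelSpace) :
    truncatedFourier (Uinv y) = Uinv (contractiveMul continuous_Fmat norm_Fmat_le y) := by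
  refine dense_compactlySupported_model.induction (P := fun y => truncatedFourier (Uinv y) =
    Uinv (contractiveMul continuous_Fmat norm_Fmat_le y)) (fun y hy => ?_)
    (isClosed_eq (by fun_prop) (by fun_prop)) y
  have hM := contractiveMul_ae_eq continuous_Fmat norm_Fmat_le y
  -- Multiplication does not enlarge the support, so `Uinv` of the product is still given by its
  -- integral.
  have hMy : contractiveMul continuous_Fmat norm_Fmat_le y ∈
      compactlySupported (EuclideanSpace ℂ (Fin 2)) modelMeasure := by
    obtain ⟨a, b, ha, h⟩ := hy
    refine ⟨a, b, ha, ?_⟩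
    filter_upwards [h, hM] with μ h1 h2 h3
    rw [h2, h1 h3, map_zero]
  refine Lp.ext ((truncatedFourier_Uinv_ae_eq hy).trans (EventuallyEq.trans ?_
    (Uinv_ae_eq hMy).symm))
  refine ae_of_all _ fun t => integral_congr_ae ?_
  filter_upwards [hM] with μ h
  rw [h]

lemma truncatedFourier_eq (x : L2Half) :
    truncatedFourier x = Uinv (contractiveMul continuous_Fmat norm_Fmat_le (U x)) := by
  rw [← truncatedFourier_comp_Uinv, Uinv_U]

lemma continuous_Fmat_conjTranspose : Continuous fun μ => (Fmat μ).conjTranspose :=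
  continuous_Fmat.matrix_conjTranspose

lemma adjoint_truncatedFourier_eq (x : L2Half) :
    truncatedFourier.adjoint x =
      Uinv (contractiveMul continuous_Fmat_conjTranspose norm_Fmat_conjTranspose_le (U x)) := by
  have h : truncatedFourier = Uinv ∘L contractiveMul continuous_Fmat norm_Fmat_le ∘L U :=
    ContinuousLinearMap.ext truncatedFourier_eq
  rw [h, ContinuousLinearMap.adjoint_comp, ContinuousLinearMap.adjoint_comp, adjoint_U,
    adjoint_Uinv, adjoint_contractiveMul _ _ continuous_Fmat_conjTranspose
      norm_Fmat_conjTranspose_le]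
  rfl

end TruncatedFourier

open TruncatedFourier in
/-- Functional model of the Fourier operator truncated on the positive half-axis. -/
theorem mainTheorem1 :
    -- the operators are given by their integrals on the functions where these converge
    (∀ x : L2Half, Integrable x halfMeasure →
      (truncatedFourier x =ᵐ[halfMeasure] fun t =>
        1 / (Real.sqrt (2 * Real.pi) : ℂ) *
          ∫ ξ in Ioi (0 : ℝ), Complex.exp (Complex.I * t * ξ) * x ξ) ∧
      (truncatedFourier.adjoint x =ᵐ[halfMeasure] fun t =>
        1 / (Real.sqrt (2 * Real.pi) : ℂ) *
          ∫ ξ in Ioi (0 : ℝ), Complex.exp (-(Complex.I * t * ξ)) * x ξ)) ∧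
    (∀ x ∈ compactlySupported ℂ halfMeasure, U x =ᵐ[modelMeasure] hat x) ∧
    (∀ y ∈ compactlySupported (EuclideanSpace ℂ (Fin 2)) modelMeasure,
      Uinv y =ᵐ[halfMeasure] check y) ∧
    -- `U` and `Uinv` are unitary, onto, and inverse to each other
    ((∀ x, ‖U x‖ = ‖x‖) ∧ Function.Surjective U) ∧
    ((∀ y, ‖Uinv y‖ = ‖y‖) ∧ Function.Surjective Uinv) ∧
    ((∀ x, Uinv (U x) = x) ∧ ∀ y, U (Uinv y) = y) ∧
    -- the transforms of the images of `x` are `F x̂` and `F* x̂`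
    (∀ x : L2Half,
      (U (truncatedFourier x) =ᵐ[modelMeasure] fun μ => (Fmat μ).toEuclideanLin (U x μ)) ∧
      (U (truncatedFourier.adjoint x) =ᵐ[modelMeasure]
        fun μ => (Fmat μ).conjTranspose.toEuclideanLin (U x μ))) ∧
    -- the images of `x` are the inverse transforms of `F x̂` and `F* x̂`
    ((mulOp Fmat).domain = ⊤ ∧ (mulOp fun μ => (Fmat μ).conjTranspose).domain = ⊤) ∧
    (∀ x : L2Half,
      (∃ h : U x ∈ (mulOp Fmat).domain, truncatedFourier x = Uinv (mulOp Fmat ⟨U x, h⟩)) ∧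
      (∃ h : U x ∈ (mulOp fun μ => (Fmat μ).conjTranspose).domain,
        truncatedFourier.adjoint x =
          Uinv ((mulOp fun μ => (Fmat μ).conjTranspose) ⟨U x, h⟩))) := by
  refine ⟨fun x hx => ⟨truncatedFourier_ae_eq hx, ?_⟩, fun x hx => U_ae_eq hx,
    fun y hy => Uinv_ae_eq hy, ⟨norm_U, fun y => ⟨Uinv y, U_Uinv y⟩⟩,
    ⟨norm_Uinv, fun x => ⟨U x, Uinv_U x⟩⟩, ⟨Uinv_U, U_Uinv⟩, fun x => ⟨?_, ?_⟩,
    ⟨mulOp_domain_eq_top continuous_Fmat norm_Fmat_le,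
      mulOp_domain_eq_top continuous_Fmat_conjTranspose norm_Fmat_conjTranspose_le⟩,
    fun x => ⟨⟨memLp_mul_of_contractive continuous_Fmat norm_Fmat_le _, truncatedFourier_eq x⟩,
      ⟨memLp_mul_of_contractive continuous_Fmat_conjTranspose norm_Fmat_conjTranspose_le _,
        adjoint_truncatedFourier_eq x⟩⟩⟩
  · refine (adjoint_truncatedFourier_ae_eq hx).trans (ae_of_all _ fun t => ?_)
    simp [fourierIntegral]
  · rw [truncatedFourier_eq, U_Uinv]
    exact contractiveMul_ae_eq _ _ _
  · rw [adjoint_truncatedFourier_eq, U_Uinv]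
    exact contractiveMul_ae_eq _ _ _
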